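/- Let $t\ge 1$ be an integer, let $\Sigma_t=\{x,z_1,\dots,z_{t+1}\}$ be an alphabet with $t+2$ distinct letters, and let $$L_t=z_1x^*z_2x^*z_3\cdots z_tx^*z_{t+1}=\{z_1x^{m_1}z_2x^{m_2}\cdots z_tx^{m_t}z_{t+1} : m_1,\dots,m_t\in\mathbb{N}\}\subseteq\Sigma_t^*,$$ where $\mathbb{N}$ contains $0$. Then it is decidable whether a given monoid morphism $\mu$ from $\Sigma_t^*$ to the multiplicative monoid of upper-triangular $2\times 2$ matrices with rational entries, such that $\mu(z_i)$ is nonsingular for $i=1,\dots,t+1$, is injective on $L_t$. That is, there is a total computable function which, given the entries (as numerators and denominators in lowest terms) of the matrices $\mu(x),\mu(z_1),\dots,\mu(z_{t+1})$ of any such $\mu$, answers "yes" if $\mu$ is injective on $L_t$ and "no" otherwise. (The matrix $\mu(x)$ may be singular.) -/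

import Mathlib

/-- The alphabet `{x, z_1, …, z_{t+1}}` with `t + 2` letters. The letters `z` are indexed from `0`:
`Letter.z i` is the letter usually written `z_{i+1}`. -/
inductive Letter (t : ℕ) : Type
  | x : Letter t
  | z (i : Fin (t + 1)) : Letter t

/-- The bounded language `z_1 x* z_2 x* z_3 ⋯ z_t x* z_{t+1}`: the words
`z_1 x^{m_1} z_2 x^{m_2} ⋯ z_t x^{m_t} z_{t+1}`, where `m_1, …, m_t` are natural numbers. -/
def boundedLang (t : ℕ) : Set (FreeMonoid (Letter t)) :=
  {w | ∃ m : Fin t → ℕ,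
    w = FreeMonoid.of (Letter.z 0) *
      (List.ofFn fun i : Fin t =>
        FreeMonoid.of Letter.x ^ m i * FreeMonoid.of (Letter.z i.succ)).prod}

/-- The (multiplicative) monoid of upper-triangular `2 × 2` matrices with rational entries. -/
abbrev UpperTri : Type := Matrix.blockTriangularSubsemiring ℚ (id : Fin 2 → Fin 2)

/-- A rational number as finite data: numerator and denominator in lowest terms. -/
abbrev RatCode : Type := ℤ × ℕ

/-- The code (numerator, denominator) of a rational number. -/
def ratCode (q : ℚ) : RatCode := (q.num, q.den)

/-- An upper-triangular `2 × 2` matrix as finite data: its three entries on and above the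
diagonal. -/
abbrev MatCode : Type := RatCode × RatCode × RatCode

/-- The code of an upper-triangular matrix: its entries in the order (1,1), (1,2), (2,2). -/
def matCode (M : UpperTri) : MatCode :=
  (ratCode (M.1 0 0), ratCode (M.1 0 1), ratCode (M.1 1 1))

/-- The input of a decision procedure: the codes of the image of `x` and of the list of the images
of `z_1, …, z_{t+1}`, which together determine the morphism. -/
def morphismCode {t : ℕ} (μ : FreeMonoid (Letter t) →* UpperTri) : MatCode × List MatCode :=
  (matCode (μ (FreeMonoid.of Letter.x)),
    List.ofFn fun i : Fin (t + 1) => matCode (μ (FreeMonoid.of (Letter.z i))))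

/-! Injectivity fails exactly when two different exponent vectors $m, n$ give the same product of
matrices. Let $a, d$ be the diagonal entries of $\mu(x)$. Since the $\mu(z_i)$ are nonsingular,
their diagonal entries cancel, and a collision forces $a^{\sum m}=a^{\sum n}$ and $d^{\sum
m}=d^{\sum n}$. Unless $a, d\in\{0,1,-1\}$, the two sums therefore agree (`TripleCollision.sum_eq`).
With equal sums only the off-diagonal entry matters, and all matrices may be scaled to integer ones
(`balancedCollision_iff`).

Let $U, V$ be the scaled diagonal entries of $\mu(x)$. If $U\ne V$, diagonalizing $\mu(x)$ turns the
off-diagonal entry into $\sum_i c_iU^{s_i}V^{S-s_i}$, where the $s_i$ are the partial sums of the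
exponents and $S$ is their total (`offDiag_tword`). If moreover $U,V\ne0$, $|U|\ne|V|$ and $S$ is
large, the at most $2t+2$ exponents in the collision equation leave a long gap, at which the
equation splits into two vanishing sums (`exists_split`). Deleting an unused exponent from the gap
gives a collision with smaller $S$ (`ExpCollision.exists_shift`), so it suffices to search below a
computable bound.

The other cases are explicit. If $U=-V$ or one of them is $0$, then $UV^3=U^3V$, and the exponents
$(1,3,0,\dots)$ and $(3,1,0,\dots)$ collide once $t\ge2$. If $U=V\ne0$, the off-diagonal entry is
affine in the exponents up to a power of $U$: a kernel vector gives a collision for $t\ge3$, and one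
test pair decides balanced collisions for $t=2$. If $a,d\in\{0,1,-1\}$, either the powers of
$\mu(x)$ repeat, or $a=d=\pm1$ with nonzero off-diagonal entry, where injectivity holds only for
$t=1$. For fixed $t$ all these tests are primitive recursive. -/

/-! ### Splitting vanishing exponential sums at a gap. -/

/-- The distances from the top beyond which a vanishing exponential sum with coefficients of total
size at most `C` and bases of size at most `M` has to split. -/
def gapBound (C M : ℕ) : ℕ → ℕ
  | 0 => 0
  | k + 1 => gapBound C M k + C * M ^ (gapBound C M k + 1) + 1

theorem gapBound_strictMono (C M : ℕ) : StrictMono (gapBound C M) :=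
  strictMono_nat_of_lt_succ fun k => by rw [gapBound]; omega

/-- Bernoulli's inequality $(1+1/v)^G\ge 1+G/v$ with denominators cleared, so that it stays in `ℕ`.
-/
theorem pow_mul_add_le_succ_pow_mul (v G : ℕ) : v ^ G * (v + G) ≤ (v + 1) ^ G * v := by
  induction G with
  | zero => simp
  | succ G ih =>
    calc v ^ (G + 1) * (v + (G + 1)) ≤ v ^ G * (v + G) * (v + 1) := by
          rw [pow_succ, mul_assoc, mul_assoc]
          exact Nat.mul_le_mul_left _ (by nlinarith)
      _ ≤ (v + 1) ^ G * v * (v + 1) := Nat.mul_le_mul_right _ ih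
      _ = (v + 1) ^ (G + 1) * v := by ring

section Split

variable {ι : Type*} [Fintype ι]

/-- If the exponents are either within `W` of the top or a long gap below that, then the top part
of a vanishing exponential sum vanishes. -/
theorem sum_top_eq_zero_of_gap (e : ι → ℤ) (n : ι → ℕ) (U V : ℤ) (S C M W L : ℕ)
    (hUV : V.natAbs < U.natAbs) (hV : V ≠ 0) (hM : V.natAbs ≤ M)
    (hC : ∑ j, (e j).natAbs ≤ C)
    (hL : L + C * M ^ (W + 1) + W = S) (hgap : ∀ j, S ≤ n j + W ∨ n j ≤ L)
    (h0 : ∑ j, e j * U ^ n j * V ^ (S - n j) = 0) :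
    ∑ j, (if S ≤ n j + W then e j * U ^ n j * V ^ (S - n j) else 0) = 0 := by
  classical
  set H := ∑ j, (if S ≤ n j + W then e j * U ^ n j * V ^ (S - n j) else 0) with hH
  by_contra hne
  -- If the top part `H` is nonzero, divisibility by a high power of `U` makes it large, while as
  -- minus the low part it is small.
  have hdvd : U ^ (S - W) ∣ H := by
    refine Finset.dvd_sum fun j _ => ?_
    split_ifs with h
    · exact Dvd.dvd.mul_right (Dvd.dvd.mul_left (pow_dvd_pow _ (by omega)) _) _
    · exact dvd_zero _
  have hlow : H = -∑ j, (if S ≤ n j + W then 0 else e j * U ^ n j * V ^ (S - n j)) := by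
    rw [eq_neg_iff_add_eq_zero, hH, ← Finset.sum_add_distrib]
    refine Eq.trans ?_ h0
    refine Finset.sum_congr rfl fun j _ => ?_
    split_ifs <;> simp
  have hle : H.natAbs ≤ C * (U.natAbs ^ L * V.natAbs ^ (S - L)) := by
    rw [hlow, Int.natAbs_neg]
    refine (Int.natAbs_sum_le _ _).trans ?_
    refine le_trans ?_ (Nat.mul_le_mul_right _ hC)
    rw [Finset.sum_mul]
    refine Finset.sum_le_sum fun j _ => ?_
    split_ifs with h
    · simp
    · have hj : n j ≤ L := (hgap j).resolve_left h
      rw [Int.natAbs_mul, Int.natAbs_mul, Int.natAbs_pow, Int.natAbs_pow, mul_assoc]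
      refine Nat.mul_le_mul_left _ ?_
      obtain ⟨d, rfl⟩ := Nat.exists_eq_add_of_le hj
      have : S - n j = d + (S - (n j + d)) := by omega
      rw [this, pow_add, pow_add, ← mul_assoc]
      exact Nat.mul_le_mul_right _ (Nat.mul_le_mul_left _ (Nat.pow_le_pow_left hUV.le _))
  have hge : U.natAbs ^ (S - W) ≤ H.natAbs := by
    rw [← Int.natAbs_pow]
    exact Nat.le_of_dvd (Int.natAbs_pos.2 hne) (Int.natAbs_dvd_natAbs.2 hdvd)
  set G := C * M ^ (W + 1) with hG
  set u := U.natAbs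
  set v := V.natAbs
  have hv : 0 < v := Int.natAbs_pos.2 hV
  have h1 : u ^ G ≤ C * v ^ (W + G) := by
    have h2 := hge.trans hle
    rw [show S - W = L + G by omega, show S - L = W + G by omega, pow_add] at h2
    have h3 : u ^ L * u ^ G ≤ u ^ L * (C * v ^ (W + G)) := h2.trans_eq (by ring)
    exact Nat.le_of_mul_le_mul_left h3 (Nat.pow_pos (by omega))
  -- Bernoulli with $u\ge v+1$ gives $v+G\le Cv^{W+1}\le G$, which contradicts $v>0$.
  have h3 : v ^ G * (v + G) ≤ v ^ G * (C * v ^ (W + 1)) :=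
    calc v ^ G * (v + G) ≤ (v + 1) ^ G * v := pow_mul_add_le_succ_pow_mul v G
      _ ≤ u ^ G * v := Nat.mul_le_mul_right _ (Nat.pow_le_pow_left hUV _)
      _ ≤ C * v ^ (W + G) * v := Nat.mul_le_mul_right _ h1
      _ = v ^ G * (C * v ^ (W + 1)) := by ring
  have h4 := Nat.le_of_mul_le_mul_left h3 (by positivity)
  have h5 : C * v ^ (W + 1) ≤ G := Nat.mul_le_mul_left _ (Nat.pow_le_pow_left hM _)
  omega

/-- Pigeonhole: the distances `S - n j` cannot meet all of the `Fintype.card ι + 1` disjoint windows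
between consecutive values of `gapBound`, and an empty window is a gap long enough for
`sum_top_eq_zero_of_gap`. -/
theorem exists_split_of_natAbs_lt (e : ι → ℤ) (n : ι → ℕ) (U V : ℤ) (S C M : ℕ)
    (hUV : V.natAbs < U.natAbs) (hV : V ≠ 0) (hM : V.natAbs ≤ M)
    (hn : ∀ j, n j ≤ S) (hC : ∑ j, (e j).natAbs ≤ C)
    (hS : gapBound C M (Fintype.card ι + 1) < S)
    (h0 : ∑ j, e j * U ^ n j * V ^ (S - n j) = 0) :
    ∃ g, 0 < g ∧ g < S ∧ (∀ j, n j ≠ g) ∧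
      ∑ j, (if g < n j then e j * U ^ n j * V ^ (S - n j) else 0) = 0 := by
  classical
  obtain ⟨k, hk⟩ : ∃ k : Fin (Fintype.card ι + 1), ∀ j,
      ¬ (gapBound C M k < S - n j ∧ S - n j ≤ gapBound C M (k + 1)) := by
    by_contra! hcon
    choose f hf1 hf2 using hcon
    have hinj : Function.Injective f := by
      have key : ∀ a b, f a = f b → ¬ (a : Fin (Fintype.card ι + 1)) < b := by
        intro a b hab hlt
        have h1 := hf2 a
        have h2 := hf1 b
        rw [hab] at h1
        have := (gapBound_strictMono C M).monotone (show (a : ℕ) + 1 ≤ b from hlt)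
        omega
      intro a b hab
      exact le_antisymm (not_lt.1 (key b a hab.symm)) (not_lt.1 (key a b hab))
    have := Fintype.card_le_of_injective f hinj
    simp at this
  have hkS : gapBound C M (k + 1) < S :=
    lt_of_le_of_lt ((gapBound_strictMono C M).monotone (by omega)) hS
  have hrec : gapBound C M (k + 1) =
    gapBound C M k + C * M ^ (gapBound C M k + 1) + 1 := rfl
  set W := gapBound C M k
  set G := C * M ^ (W + 1) with hG
  -- The exponent at distance `W + 1` from the top, the first one in the empty window.
  refine ⟨S - W - 1, by omega, by omega, fun j hj => hk j (by omega), ?_⟩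
  have := sum_top_eq_zero_of_gap e n U V S C M W (S - W - G) hUV hV hM hC (by omega)
    (fun j => by have := hk j; have := hn j; omega) h0
  rw [← this]
  refine Finset.sum_congr rfl fun j _ => ?_
  have := hk j
  have := hn j
  congr 1
  apply propext
  omega

theorem exists_split (e : ι → ℤ) (n : ι → ℕ) (U V : ℤ) (S C M : ℕ)
    (hUV : U.natAbs ≠ V.natAbs) (hU : U ≠ 0) (hV : V ≠ 0) (hUM : U.natAbs ≤ M)
    (hVM : V.natAbs ≤ M) (hn : ∀ j, n j ≤ S) (hC : ∑ j, (e j).natAbs ≤ C)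
    (hS : gapBound C M (Fintype.card ι + 1) < S)
    (h0 : ∑ j, e j * U ^ n j * V ^ (S - n j) = 0) :
    ∃ g, 0 < g ∧ g < S ∧ (∀ j, n j ≠ g) ∧
      ∑ j, (if g < n j then e j * U ^ n j * V ^ (S - n j) else 0) = 0 := by
  rcases lt_or_gt_of_ne hUV with h | h
  -- Reflecting the exponents, `n ↦ S - n`, exchanges the two bases; the complementary part of the
  -- sum then vanishes too.
  · obtain ⟨g, hg0, hgS, hg, hsum⟩ := exists_split_of_natAbs_lt e (fun j => S - n j) V U S C M
      h hU hUM (fun j => Nat.sub_le _ _) hC hS (by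
        rw [← h0]
        refine Finset.sum_congr rfl fun j _ => ?_
        rw [Nat.sub_sub_self (hn j)]
        ring)
    refine ⟨S - g, by omega, by omega, fun j => by have := hg j; have := hn j; omega, ?_⟩
    have : ∑ j, (if S - g < n j then e j * U ^ n j * V ^ (S - n j) else 0) +
        ∑ j, (if g < S - n j then e j * V ^ (S - n j) * U ^ (S - (S - n j)) else 0) = 0 := by
      rw [← Finset.sum_add_distrib]
      refine Eq.trans ?_ h0
      refine Finset.sum_congr rfl fun j _ => ?_
      have h1 := hg j
      have h2 := hn j
      rw [Nat.sub_sub_self h2]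
      by_cases h3 : S - g < n j
      · rw [if_pos h3, if_neg (by omega), add_zero]
      · rw [if_neg h3, if_pos (by omega)]
        ring
    rwa [hsum, add_zero] at this
  · exact exists_split_of_natAbs_lt e n U V S C M h hV hVM hn hC hS h0

/-- Removing an unused exponent at which a vanishing exponential sum splits. -/
theorem sum_shift_eq_zero (e : ι → ℤ) (n : ι → ℕ) (U V : ℤ) (S g : ℕ)
    (hU : U ≠ 0) (hV : V ≠ 0) (hn : ∀ j, n j ≤ S) (hgS : g < S)
    (hg : ∀ j, n j ≠ g) (h0 : ∑ j, e j * U ^ n j * V ^ (S - n j) = 0)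
    (hsplit : ∑ j, (if g < n j then e j * U ^ n j * V ^ (S - n j) else 0) = 0) :
    ∑ j, e j * U ^ (if n j < g then n j else n j - 1) *
      V ^ (S - 1 - (if n j < g then n j else n j - 1)) = 0 := by
  have hlow : ∑ j, (if n j < g then e j * U ^ n j * V ^ (S - n j) else 0) = 0 := by
    refine Eq.trans ?_ ((congrArg₂ (· - ·) h0 hsplit).trans (sub_zero 0))
    rw [← Finset.sum_sub_distrib]
    refine Finset.sum_congr rfl fun j _ => ?_
    have h1 := hg j
    by_cases h2 : n j < g
    · rw [if_pos h2, if_neg (by omega), sub_zero]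
    · rw [if_neg h2, if_pos (by omega), sub_self]
  -- Both parts vanish separately, so the low one may be divided by `V` and the high one by `U`;
  -- each lowers the total degree by one.
  have hlow' : V * ∑ j, (if n j < g then e j * U ^ n j * V ^ (S - 1 - n j) else 0) = 0 := by
    rw [Finset.mul_sum]
    refine Eq.trans ?_ hlow
    refine Finset.sum_congr rfl fun j _ => ?_
    split_ifs
    · rw [show S - n j = (S - 1 - n j) + 1 by omega]
      ring
    · simp
  have hhigh' : U * ∑ j, (if g < n j then e j * U ^ (n j - 1) * V ^ (S - n j) else 0) = 0 := by
    rw [Finset.mul_sum]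
    refine Eq.trans ?_ hsplit
    refine Finset.sum_congr rfl fun j _ => ?_
    split_ifs
    · obtain ⟨k, hk⟩ : ∃ k, n j = k + 1 := ⟨n j - 1, by omega⟩
      rw [hk, Nat.add_sub_cancel]
      ring
    · simp
  have hlow'' := (mul_eq_zero.1 hlow').resolve_left hV
  have hhigh'' := (mul_eq_zero.1 hhigh').resolve_left hU
  have hadd := congrArg₂ (· + ·) hlow'' hhigh''
  simp only [← Finset.sum_add_distrib, add_zero] at hadd
  rw [← hadd]
  refine Finset.sum_congr rfl fun j _ => ?_
  have h1 := hg j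
  have h2 := hn j
  by_cases h3 : n j < g
  · rw [if_pos h3, if_pos h3, if_neg (by omega), add_zero]
  · rw [if_neg h3, if_neg h3, if_pos (by omega), zero_add,
      show S - 1 - (n j - 1) = S - n j by omega]

end Split

/-! ### Descent on collisions of exponential polynomials. -/

/-- Two exponent vectors with the same sum that differ below `t` and at which an exponential
polynomial in the partial sums takes the same value. -/
def ExpCollision (c : ℕ → ℤ) (U V : ℤ) (t : ℕ) (m n : ℕ → ℕ) : Prop :=
  (∃ i < t, m i ≠ n i) ∧ ∑ i ∈ Finset.range t, m i = ∑ i ∈ Finset.range t, n i ∧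
    ∑ i ∈ Finset.range (t + 1), c i * U ^ (∑ j ∈ Finset.range i, m j) *
      V ^ (∑ j ∈ Finset.range t, m j - ∑ j ∈ Finset.range i, m j) =
    ∑ i ∈ Finset.range (t + 1), c i * U ^ (∑ j ∈ Finset.range i, n j) *
      V ^ (∑ j ∈ Finset.range t, n j - ∑ j ∈ Finset.range i, n j)

/-- The difference of the two sides is one vanishing sum over the partial sums of both vectors. It
splits at a value `g` that no partial sum takes; closing up this value shortens both vectors by one
without merging partial sums. -/
theorem ExpCollision.exists_shift {c : ℕ → ℤ} {U V : ℤ} {t : ℕ} {m n : ℕ → ℕ}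
    (h : ExpCollision c U V t m n) (hUV : U.natAbs ≠ V.natAbs) (hU : U ≠ 0) (hV : V ≠ 0)
    {C M : ℕ} (hUM : U.natAbs ≤ M) (hVM : V.natAbs ≤ M)
    (hC : 2 * ∑ i ∈ Finset.range (t + 1), (c i).natAbs ≤ C)
    (hS : gapBound C M (2 * t + 3) < ∑ i ∈ Finset.range t, m i) :
    ∃ m' n', ExpCollision c U V t m' n' ∧
      ∑ i ∈ Finset.range t, m' i < ∑ i ∈ Finset.range t, m i := by
  obtain ⟨⟨i₀, hi₀, hne⟩, hsum, heq⟩ := h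
  rw [← hsum] at heq
  set S := ∑ i ∈ Finset.range t, m i with hSdef
  have hmono : ∀ f : ℕ → ℕ, Monotone fun i => ∑ j ∈ Finset.range i, f j := fun f a b hab =>
    Finset.sum_le_sum_of_subset (Finset.range_mono hab)
  let e : Fin (t + 1) ⊕ Fin (t + 1) → ℤ := Sum.elim (fun i => c i) (fun i => -c i)
  let s : Fin (t + 1) ⊕ Fin (t + 1) → ℕ :=
    Sum.elim (fun i => ∑ j ∈ Finset.range i, m j) (fun i => ∑ j ∈ Finset.range i, n j)
  have hs : ∀ j, s j ≤ S := by
    rintro (i | i)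
    · exact hmono m (Nat.lt_succ_iff.1 i.2)
    · rw [hsum]
      exact hmono n (Nat.lt_succ_iff.1 i.2)
  have h0 : ∑ j, e j * U ^ s j * V ^ (S - s j) = 0 := by
    rw [Finset.sum_range, Finset.sum_range] at heq
    simp only [Fintype.sum_sum_type, e, s, Sum.elim_inl, Sum.elim_inr, neg_mul,
      Finset.sum_neg_distrib]
    rw [heq, add_neg_cancel]
  obtain ⟨g, hg0, hgS, hg, hsplit⟩ := exists_split e s U V S C M hUV hU hV hUM hVM hs
    (by
      simp only [Fintype.sum_sum_type, e, Sum.elim_inl, Sum.elim_inr, Int.natAbs_neg]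
      rw [Finset.sum_range] at hC
      omega)
    (by
      -- There are `t + 1` partial sums on each side, and the pigeonhole needs one more window.
      rw [Fintype.card_sum, Fintype.card_fin]
      convert hS using 2
      ring) h0
  have hshift := sum_shift_eq_zero e s U V S g hU hV hs hgS hg h0 hsplit
  let φ : ℕ → ℕ := fun v => if v < g then v else v - 1
  have hφ : Monotone φ := by
    intro a b hab
    simp only [φ]
    split_ifs <;> omega
  have hφ0 : φ 0 = 0 := by simp [φ]
  have hφS : φ S = S - 1 := by
    simp only [φ]
    rw [if_neg (by omega)]
  have hφinj : ∀ a b, a ≠ g → b ≠ g → φ a = φ b → a = b := by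
    intro a b ha hb hab
    simp only [φ] at hab
    split_ifs at hab <;> omega
  -- The exponent vector whose partial sums are the images under `φ` of the old ones.
  let sh : (ℕ → ℕ) → ℕ → ℕ := fun f i =>
    φ (∑ j ∈ Finset.range (i + 1), f j) - φ (∑ j ∈ Finset.range i, f j)
  have hsh : ∀ f i, ∑ j ∈ Finset.range i, sh f j = φ (∑ j ∈ Finset.range i, f j) := by
    intro f i
    have := Finset.sum_range_tsub (hφ.comp (hmono f)) i
    simpa [sh, hφ0] using this
  have hshm : ∑ j ∈ Finset.range t, sh m j = S - 1 := by rw [hsh, ← hSdef, hφS]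
  have hshn : ∑ j ∈ Finset.range t, sh n j = S - 1 := by rw [hsh, ← hsum, hφS]
  refine ⟨sh m, sh n, ⟨?_, by rw [hshm, hshn], ?_⟩, by omega⟩
  · by_contra! hcon
    have key : ∀ i ≤ t, ∑ j ∈ Finset.range i, m j = ∑ j ∈ Finset.range i, n j := by
      intro i hi
      refine hφinj _ _ (hg (Sum.inl ⟨i, by omega⟩)) (hg (Sum.inr ⟨i, by omega⟩)) ?_
      rw [← hsh, ← hsh]
      exact Finset.sum_congr rfl fun j hj => hcon j (by rw [Finset.mem_range] at hj; omega)
    have h1 := key (i₀ + 1) hi₀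
    rw [Finset.sum_range_succ, Finset.sum_range_succ, key i₀ hi₀.le] at h1
    omega
  · rw [hshm, hshn]
    simp only [hsh]
    rw [Finset.sum_range, Finset.sum_range]
    simp only [Fintype.sum_sum_type, e, s, Sum.elim_inl, Sum.elim_inr, neg_mul,
      Finset.sum_neg_distrib] at hshift
    exact add_neg_eq_zero.1 hshift

theorem ExpCollision.exists_bounded {c : ℕ → ℤ} {U V : ℤ} {t : ℕ} {m n : ℕ → ℕ}
    (h : ExpCollision c U V t m n) (hUV : U.natAbs ≠ V.natAbs) (hU : U ≠ 0) (hV : V ≠ 0)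
    {C M : ℕ} (hUM : U.natAbs ≤ M) (hVM : V.natAbs ≤ M)
    (hC : 2 * ∑ i ∈ Finset.range (t + 1), (c i).natAbs ≤ C) :
    ∃ m' n', ExpCollision c U V t m' n' ∧
      ∑ i ∈ Finset.range t, m' i ≤ gapBound C M (2 * t + 3) := by
  induction hS : ∑ i ∈ Finset.range t, m i using Nat.strong_induction_on generalizing m n with
  | _ S ih =>
    by_cases hle : S ≤ gapBound C M (2 * t + 3)
    · exact ⟨m, n, h, hS ▸ hle⟩
    · obtain ⟨m', n', h', hlt⟩ := h.exists_shift hUV hU hV hUM hVM hC (by omega)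
      exact ih _ (hS ▸ hlt) h' rfl

/-! ### Products of triangular matrices as triples. -/

section Triples

variable {K : Type*}

/-- The product of upper-triangular `2 × 2` matrices given by their entries (1,1), (1,2), (2,2). -/
def tmul [CommRing K] (M N : K × K × K) : K × K × K :=
  (M.1 * N.1, M.1 * N.2.1 + M.2.1 * N.2.2, M.2.2 * N.2.2)

def tpow [CommRing K] (X : K × K × K) : ℕ → K × K × K
  | 0 => (1, 0, 1)
  | k + 1 => tmul (tpow X k) X

/-- The product `z_0 x^{m_0} z_1 ⋯ x^{m_{k-1}} z_k` of triples. -/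
def tword [CommRing K] (X : K × K × K) (Z : ℕ → K × K × K) (m : ℕ → ℕ) : ℕ → K × K × K
  | 0 => Z 0
  | k + 1 => tmul (tmul (tword X Z m k) (tpow X (m k))) (Z (k + 1))

/-- The word `z_0 x^{m_0} z_1 ⋯ x^{m_{k-1}} z_k` in a monoid. -/
def bword {G : Type*} [Monoid G] (x : G) (z : ℕ → G) (m : ℕ → ℕ) : ℕ → G
  | 0 => z 0
  | k + 1 => bword x z m k * x ^ m k * z (k + 1)

theorem map_bword {G H : Type*} [Monoid G] [Monoid H] (f : G →* H) (x : G) (z : ℕ → G)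
    (m : ℕ → ℕ) (k : ℕ) : f (bword x z m k) = bword (f x) (fun i => f (z i)) m k := by
  induction k with
  | zero => rfl
  | succ k ih => simp [bword, ih]

theorem bword_congr {G : Type*} [Monoid G] (x : G) (z : ℕ → G) (m n : ℕ → ℕ) (k : ℕ)
    (h : ∀ i < k, x ^ m i = x ^ n i) : bword x z m k = bword x z n k := by
  induction k with
  | zero => rfl
  | succ k ih => rw [bword, bword, ih fun i hi => h i (by omega), h k (by omega)]

variable [CommRing K]

theorem tpow_fst (X : K × K × K) (k : ℕ) : (tpow X k).1 = X.1 ^ k := by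
  induction k with
  | zero => simp [tpow]
  | succ k ih => simp [tpow, tmul, ih, pow_succ]

theorem tpow_snd_snd (X : K × K × K) (k : ℕ) : (tpow X k).2.2 = X.2.2 ^ k := by
  induction k with
  | zero => simp [tpow]
  | succ k ih => simp [tpow, tmul, ih, pow_succ]

theorem tword_fst (X : K × K × K) (Z : ℕ → K × K × K) (m : ℕ → ℕ) (k : ℕ) :
    (tword X Z m k).1 =
      X.1 ^ (∑ i ∈ Finset.range k, m i) * ∏ i ∈ Finset.range (k + 1), (Z i).1 := by
  induction k with
  | zero => simp [tword]
  | succ k ih =>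
    rw [Finset.prod_range_succ, Finset.sum_range_succ, tword, tmul, tmul, ih, tpow_fst, pow_add]
    ring

theorem tword_snd_snd (X : K × K × K) (Z : ℕ → K × K × K) (m : ℕ → ℕ) (k : ℕ) :
    (tword X Z m k).2.2 =
      X.2.2 ^ (∑ i ∈ Finset.range k, m i) * ∏ i ∈ Finset.range (k + 1), (Z i).2.2 := by
  induction k with
  | zero => simp [tword]
  | succ k ih =>
    rw [Finset.prod_range_succ, Finset.sum_range_succ, tword, tmul, tmul, ih, tpow_snd_snd,
      pow_add]
    ring

/-- The off-diagonal entry, up to a factor, after diagonalizing `X`. -/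
def offDiag (X M : K × K × K) : K := M.2.1 * (X.2.2 - X.1) + X.2.1 * (M.1 - M.2.2)

/-- Conjugation preserves the product rule for the (1,2) entry, and `offDiag X` is that entry times
`X.2.2 - X.1` in a basis where `X` is diagonal. Powers of `X` thus contribute nothing. -/
theorem offDiag_tmul (X M N : K × K × K) :
    offDiag X (tmul M N) = M.1 * offDiag X N + offDiag X M * N.2.2 := by
  simp only [offDiag, tmul]
  ring

theorem offDiag_tpow (X : K × K × K) (k : ℕ) : offDiag X (tpow X k) = 0 := by
  induction k with
  | zero => simp [offDiag, tpow]
  | succ k ih =>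
    rw [tpow, offDiag_tmul, ih]
    simp only [offDiag]
    ring

/-- The coefficients of `offDiag X (tword X Z m k)` as an exponential polynomial in the partial
sums of `m`. -/
def expCoef (X : K × K × K) (Z : ℕ → K × K × K) : ℕ → ℕ → K
  | 0, _ => offDiag X (Z 0)
  | k + 1, i =>
    if i ≤ k then expCoef X Z k i * (Z (k + 1)).2.2
    else (∏ j ∈ Finset.range (k + 1), (Z j).1) * offDiag X (Z (k + 1))

theorem offDiag_tword (X : K × K × K) (Z : ℕ → K × K × K) (m : ℕ → ℕ) (k : ℕ) :
    offDiag X (tword X Z m k) =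
      ∑ i ∈ Finset.range (k + 1), expCoef X Z k i * X.1 ^ (∑ j ∈ Finset.range i, m j) *
        X.2.2 ^ (∑ j ∈ Finset.range k, m j - ∑ j ∈ Finset.range i, m j) := by
  induction k with
  | zero => simp [tword, expCoef]
  | succ k ih =>
    rw [Finset.sum_range_succ, tword, offDiag_tmul, offDiag_tmul, offDiag_tpow, ih, mul_zero,
      zero_add, tmul, tword_fst, tpow_fst, tpow_snd_snd, Finset.sum_mul, Finset.sum_mul,
      add_comm, Nat.sub_self, pow_zero, mul_one]
    congr 1
    · refine Finset.sum_congr rfl fun i hi => ?_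
      rw [Finset.mem_range] at hi
      have hle : ∑ j ∈ Finset.range i, m j ≤ ∑ j ∈ Finset.range k, m j :=
        Finset.sum_le_sum_of_subset (Finset.range_mono (by omega))
      rw [expCoef, if_pos (by omega), Finset.sum_range_succ, Nat.sub_add_comm hle, pow_add]
      ring
    · rw [expCoef, if_neg (by omega), Finset.sum_range_succ, pow_add]
      ring

/-- If the diagonal of `X` is constant, the off-diagonal entry is a linear function of the
exponents, up to a power of the diagonal entry. -/
theorem exists_linear_tword [IsDomain K] (X : K × K × K) (hX : X.1 = X.2.2)
    (Z : ℕ → K × K × K) (hZ : ∀ i, (Z i).1 ≠ 0 ∧ (Z i).2.2 ≠ 0) (k : ℕ) :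
    ∃ (c : K) (e : ℕ → K), (∀ i, e i ≠ 0) ∧ ∀ m : ℕ → ℕ,
      X.1 * (tword X Z m k).2.1 = X.1 ^ (∑ i ∈ Finset.range k, m i) *
        (c + X.2.1 * ∑ i ∈ Finset.range k, e i * m i) := by
  have hpow : ∀ l : ℕ, X.1 * (tpow X l).2.1 = X.1 ^ l * (X.2.1 * l) := by
    intro l
    induction l with
    | zero => simp [tpow]
    | succ l ih =>
      simp only [tpow, tmul, tpow_fst]
      rw [mul_add, ← mul_assoc X.1 (tpow X l).2.1, ih, ← hX]
      push_cast
      ring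
  induction k with
  | zero => exact ⟨X.1 * (Z 0).2.1, fun _ => 1, fun _ => one_ne_zero, fun m => by simp [tword]⟩
  | succ k ih =>
    obtain ⟨c, e, he, h⟩ := ih
    set p := ∏ j ∈ Finset.range (k + 1), (Z j).1 with hp
    have hp0 : p ≠ 0 := Finset.prod_ne_zero_iff.2 fun i _ => (hZ i).1
    refine ⟨X.1 * p * (Z (k + 1)).2.1 + c * (Z (k + 1)).2.2,
      fun i => if i < k then e i * (Z (k + 1)).2.2 else p * (Z (k + 1)).2.2, fun i => ?_,
      fun m => ?_⟩
    · dsimp only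
      split_ifs
      · exact mul_ne_zero (he i) (hZ _).2
      · exact mul_ne_zero hp0 (hZ _).2
    · dsimp only
      rw [Finset.sum_range_succ, Finset.sum_range_succ, if_neg (lt_irrefl k)]
      have hsum : ∑ i ∈ Finset.range k,
          (if i < k then e i * (Z (k + 1)).2.2 else p * (Z (k + 1)).2.2) * (m i : K) =
          (∑ i ∈ Finset.range k, e i * m i) * (Z (k + 1)).2.2 := by
        rw [Finset.sum_mul]
        refine Finset.sum_congr rfl fun i hi => ?_
        rw [if_pos (Finset.mem_range.1 hi)]
        ring
      rw [hsum]
      simp only [tword, tmul, tword_fst, tpow_fst, tpow_snd_snd, ← hX, ← hp, pow_add]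
      have h1 := h m
      have h2 := hpow (m k)
      linear_combination (X.1 ^ m k * (Z (k + 1)).2.2) * h1 +
        (X.1 ^ (∑ i ∈ Finset.range k, m i) * p * (Z (k + 1)).2.2) * h2

end Triples

/-! ### Clearing denominators, kernel vectors and coefficient bounds. -/

/-- An integer triple is `s` times a rational one. -/
def ScaledBy (s : ℚ) (A : ℤ × ℤ × ℤ) (B : ℚ × ℚ × ℚ) : Prop :=
  (A.1 : ℚ) = s * B.1 ∧ (A.2.1 : ℚ) = s * B.2.1 ∧ (A.2.2 : ℚ) = s * B.2.2

theorem ScaledBy.tmul {s s' : ℚ} {A A' : ℤ × ℤ × ℤ} {B B' : ℚ × ℚ × ℚ}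
    (h : ScaledBy s A B) (h' : ScaledBy s' A' B') :
    ScaledBy (s * s') (tmul A A') (tmul B B') := by
  obtain ⟨h1, h2, h3⟩ := h
  obtain ⟨h1', h2', h3'⟩ := h'
  simp only [ScaledBy, _root_.tmul, Int.cast_add, Int.cast_mul, h1, h2, h3, h1', h2', h3']
  exact ⟨by ring, by ring, by ring⟩

theorem ScaledBy.tpow {s : ℚ} {A : ℤ × ℤ × ℤ} {B : ℚ × ℚ × ℚ} (h : ScaledBy s A B) (k : ℕ) :
    ScaledBy (s ^ k) (tpow A k) (tpow B k) := by
  induction k with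
  | zero => simp [ScaledBy, _root_.tpow]
  | succ k ih => exact pow_succ s k ▸ ih.tmul h

theorem ScaledBy.tword {s : ℚ} {s' : ℕ → ℚ} {X : ℤ × ℤ × ℤ} {X' : ℚ × ℚ × ℚ}
    {Z : ℕ → ℤ × ℤ × ℤ} {Z' : ℕ → ℚ × ℚ × ℚ} (h : ScaledBy s X X')
    (h' : ∀ i, ScaledBy (s' i) (Z i) (Z' i)) (m : ℕ → ℕ) (k : ℕ) :
    ScaledBy (s ^ (∑ i ∈ Finset.range k, m i) * ∏ i ∈ Finset.range (k + 1), s' i)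
      (tword X Z m k) (tword X' Z' m k) := by
  induction k with
  | zero => simpa [_root_.tword] using h' 0
  | succ k ih =>
    rw [Finset.sum_range_succ, Finset.prod_range_succ, pow_add]
    rw [_root_.tword, _root_.tword]
    convert (ih.tmul (h.tpow (m k))).tmul (h' (k + 1)) using 1
    ring

theorem ScaledBy.snd_fst_eq_iff {s : ℚ} (hs : s ≠ 0) {A A' : ℤ × ℤ × ℤ} {B B' : ℚ × ℚ × ℚ}
    (h : ScaledBy s A B) (h' : ScaledBy s A' B') : A.2.1 = A'.2.1 ↔ B.2.1 = B'.2.1 := by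
  rw [← Int.cast_inj (α := ℚ), h.2.1, h'.2.1, mul_right_inj' hs]

/-- A rational homogeneous linear system with more unknowns than equations has a nonzero integer
solution. -/
theorem exists_int_kernel_vector {r t : ℕ} (hr : 0 < r) (hrt : r < t) (e : Fin r → Fin t → ℚ) :
    ∃ k : Fin t → ℤ, k ≠ 0 ∧ ∀ i, ∑ j, e i j * k j = 0 := by
  -- Denominators are cleared so that Siegel's lemma applies; only the existence of its solution is
  -- used.
  obtain ⟨b, hb⟩ := IsLocalization.exist_integer_multiples_of_finite (nonZeroDivisors ℤ)
    (fun p : Fin r × Fin t => e p.1 p.2)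
  choose A hA using hb
  obtain ⟨k, hk0, hk, -⟩ := Int.Matrix.exists_ne_zero_int_vec_norm_le
    (Matrix.of fun i j => A (i, j)) (by simpa using hrt) (by simpa using hr)
  refine ⟨k, hk0, fun i => ?_⟩
  have h1 : ((b : ℤ) : ℚ) ≠ 0 := by
    exact_mod_cast nonZeroDivisors.coe_ne_zero b
  have h2 := congrArg (Int.cast : ℤ → ℚ) (congrFun hk i)
  simp only [Matrix.mulVec, dotProduct, Matrix.of_apply, Int.cast_sum, Int.cast_mul,
    Pi.zero_apply, Int.cast_zero] at h2
  refine (mul_eq_zero.1 ?_).resolve_left h1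
  rw [Finset.mul_sum, ← h2]
  refine Finset.sum_congr rfl fun j _ => ?_
  have h3 := hA (i, j)
  simp only [algebraMap_int_eq, eq_intCast, Algebra.smul_def] at h3
  rw [h3]
  simp [mul_assoc]

theorem natAbs_expCoef_le (X : ℤ × ℤ × ℤ) (Z : ℕ → ℤ × ℤ × ℤ) (T k : ℕ)
    (hX : X.1.natAbs ≤ T ∧ X.2.1.natAbs ≤ T ∧ X.2.2.natAbs ≤ T)
    (hZ : ∀ i ≤ k, (Z i).1.natAbs ≤ T ∧ (Z i).2.1.natAbs ≤ T ∧ (Z i).2.2.natAbs ≤ T) (i : ℕ) :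
    (expCoef X Z k i).natAbs ≤ 4 * T ^ (k + 2) := by
  have hoff : ∀ j ≤ k, (offDiag X (Z j)).natAbs ≤ 4 * T ^ 2 := by
    intro j hj
    obtain ⟨h1, h2, h3⟩ := hX
    obtain ⟨h4, h5, h6⟩ := hZ j hj
    rw [offDiag]
    refine (Int.natAbs_add_le _ _).trans ?_
    rw [Int.natAbs_mul, Int.natAbs_mul]
    have h7 := (Int.natAbs_sub_le X.2.2 X.1).trans (add_le_add h3 h1)
    have h8 := (Int.natAbs_sub_le (Z j).1 (Z j).2.2).trans (add_le_add h4 h6)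
    calc _ ≤ T * (T + T) + T * (T + T) := add_le_add (Nat.mul_le_mul h5 h7) (Nat.mul_le_mul h2 h8)
      _ = 4 * T ^ 2 := by ring
  induction k with
  | zero => exact hoff 0 le_rfl
  | succ k ih =>
    rw [expCoef]
    split_ifs with hik
    · rw [Int.natAbs_mul]
      calc _ ≤ 4 * T ^ (k + 2) * T := Nat.mul_le_mul
            (ih (fun j hj => hZ j (by omega)) (fun j hj => hoff j (by omega))) (hZ _ le_rfl).2.2
        _ = 4 * T ^ (k + 1 + 2) := by ring
    · rw [Int.natAbs_mul]
      have hprod : (∏ j ∈ Finset.range (k + 1), (Z j).1).natAbs ≤ T ^ (k + 1) := by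
        rw [← Int.natAbsHom_apply, map_prod]
        refine (Finset.prod_le_pow_card _ _ T fun j hj => ?_).trans_eq (by simp)
        exact (hZ j (by rw [Finset.mem_range] at hj; omega)).1
      calc _ ≤ T ^ (k + 1) * (4 * T ^ 2) := Nat.mul_le_mul hprod (hoff _ le_rfl)
        _ = 4 * T ^ (k + 1 + 2) := by ring

/-! ### Collisions and the degenerate cases. -/

/-- Two exponent vectors that differ below `t` and give the same product of rational triples. -/
def TripleCollision (X : ℚ × ℚ × ℚ) (Z : ℕ → ℚ × ℚ × ℚ) (t : ℕ) (m n : ℕ → ℕ) : Prop :=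
  (∃ i < t, m i ≠ n i) ∧ tword X Z m t = tword X Z n t

/-- Two exponent vectors with the same sum that differ below `t` and give products of integer
triples with the same off-diagonal entry. -/
def BalancedCollision (X : ℤ × ℤ × ℤ) (Z : ℕ → ℤ × ℤ × ℤ) (t : ℕ) (m n : ℕ → ℕ) : Prop :=
  (∃ i < t, m i ≠ n i) ∧ ∑ i ∈ Finset.range t, m i = ∑ i ∈ Finset.range t, n i ∧
    (tword X Z m t).2.1 = (tword X Z n t).2.1

/-- Equal sums give both integer products the same scale factor and make the diagonal entries agree
automatically. -/
theorem balancedCollision_iff {s : ℚ} {s' : ℕ → ℚ} {X : ℤ × ℤ × ℤ} {X' : ℚ × ℚ × ℚ}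
    {Z : ℕ → ℤ × ℤ × ℤ} {Z' : ℕ → ℚ × ℚ × ℚ} (hs : s ≠ 0) (hs' : ∀ i, s' i ≠ 0)
    (h : ScaledBy s X X') (h' : ∀ i, ScaledBy (s' i) (Z i) (Z' i)) (t : ℕ) (m n : ℕ → ℕ) :
    BalancedCollision X Z t m n ↔ TripleCollision X' Z' t m n ∧
      ∑ i ∈ Finset.range t, m i = ∑ i ∈ Finset.range t, n i := by
  rw [BalancedCollision, TripleCollision, and_assoc, and_congr_right_iff]
  intro _
  rw [and_comm, and_congr_left_iff]
  intro hsum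
  have hm := h.tword h' m t
  have hn := h.tword h' n t
  rw [← hsum] at hn
  rw [hm.snd_fst_eq_iff (mul_ne_zero (pow_ne_zero _ hs)
    (Finset.prod_ne_zero_iff.2 fun i _ => hs' i)) hn]
  constructor
  · intro hQ
    refine Prod.ext ?_ (Prod.ext hQ ?_)
    · rw [tword_fst, tword_fst, hsum]
    · rw [tword_snd_snd, tword_snd_snd, hsum]
  · intro hQ
    rw [hQ]

theorem eq_of_pow_eq_pow_of_abs_ne {q : ℚ} (h0 : q ≠ 0) (h1 : |q| ≠ 1) {i j : ℕ}
    (h : q ^ i = q ^ j) : i = j := by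
  have := congrArg abs h
  rw [abs_pow, abs_pow] at this
  exact pow_right_injective₀ (abs_pos.2 h0) h1 this

theorem pow_sum_eq_of_tword_eq {X : ℚ × ℚ × ℚ} {Z : ℕ → ℚ × ℚ × ℚ} {t : ℕ} {m n : ℕ → ℕ}
    (hZ : ∀ i, (Z i).1 ≠ 0 ∧ (Z i).2.2 ≠ 0) (h : tword X Z m t = tword X Z n t) :
    X.1 ^ (∑ i ∈ Finset.range t, m i) = X.1 ^ (∑ i ∈ Finset.range t, n i) ∧
      X.2.2 ^ (∑ i ∈ Finset.range t, m i) = X.2.2 ^ (∑ i ∈ Finset.range t, n i) := by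
  constructor
  · have h1 := congrArg Prod.fst h
    rw [tword_fst, tword_fst] at h1
    exact mul_right_cancel₀ (Finset.prod_ne_zero_iff.2 fun i _ => (hZ i).1) h1
  · have h1 := congrArg (fun q => q.2.2) h
    simp only [tword_snd_snd] at h1
    exact mul_right_cancel₀ (Finset.prod_ne_zero_iff.2 fun i _ => (hZ i).2) h1

theorem TripleCollision.sum_eq {X : ℚ × ℚ × ℚ} {Z : ℕ → ℚ × ℚ × ℚ} {t : ℕ} {m n : ℕ → ℕ}
    (hZ : ∀ i, (Z i).1 ≠ 0 ∧ (Z i).2.2 ≠ 0) (h : TripleCollision X Z t m n)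
    (hX : X.1 ≠ 0 ∧ |X.1| ≠ 1 ∨ X.2.2 ≠ 0 ∧ |X.2.2| ≠ 1) :
    ∑ i ∈ Finset.range t, m i = ∑ i ∈ Finset.range t, n i := by
  obtain ⟨h1, h2⟩ := pow_sum_eq_of_tword_eq hZ h.2
  rcases hX with hX | hX
  · exact eq_of_pow_eq_pow_of_abs_ne hX.1 hX.2 h1
  · exact eq_of_pow_eq_pow_of_abs_ne hX.1 hX.2 h2

theorem exists_tripleCollision_of_kernel {X : ℚ × ℚ × ℚ} {Z : ℕ → ℚ × ℚ × ℚ} {t : ℕ}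
    (hX : X.1 = X.2.2) (hX0 : X.1 ≠ 0) {c : ℚ} {e : ℕ → ℚ}
    (he : ∀ m : ℕ → ℕ, X.1 * (tword X Z m t).2.1 = X.1 ^ (∑ i ∈ Finset.range t, m i) *
      (c + X.2.1 * ∑ i ∈ Finset.range t, e i * m i))
    (k : Fin t → ℤ) (hk : k ≠ 0) (hek : ∑ i : Fin t, e i * k i = 0)
    (hsum : X.1 ^ 2 = 1 ∨ ∑ i, k i = 0) :
    ∃ m n, TripleCollision X Z t m n := by
  let k' : ℕ → ℤ := fun i => if h : i < t then k ⟨i, h⟩ else 0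
  have hk' : ∀ i : Fin t, k' i = k i := fun i => by simp [k']
  -- Positive and negative parts of the kernel vector, doubled so that all exponents are even: if
  -- `X.1 ^ 2 = 1` the sums then need not agree.
  let m : ℕ → ℕ := fun i => 2 * (k' i).toNat
  let n : ℕ → ℕ := fun i => 2 * (-k' i).toNat
  have hmn : ∀ i, (m i : ℤ) - n i = 2 * k' i := by
    intro i
    simp only [m, n]
    omega
  have hpow : X.1 ^ (∑ i ∈ Finset.range t, m i) = X.1 ^ (∑ i ∈ Finset.range t, n i) := by
    rcases hsum with h | h
    · simp only [m, n, ← Finset.mul_sum]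
      rw [pow_mul, pow_mul, h, one_pow, one_pow]
    · congr 1
      zify
      rw [← sub_eq_zero, ← Finset.sum_sub_distrib, Finset.sum_congr rfl fun i _ => hmn i,
        ← Finset.mul_sum, Finset.sum_range, Finset.sum_congr rfl fun i _ => hk' i, h, mul_zero]
  have hlin : ∑ i ∈ Finset.range t, e i * (m i : ℚ) = ∑ i ∈ Finset.range t, e i * (n i : ℚ) := by
    rw [← sub_eq_zero, ← Finset.sum_sub_distrib]
    have : ∀ i, e i * (m i : ℚ) - e i * (n i : ℚ) = 2 * (e i * (k' i : ℚ)) := by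
      intro i
      have := congrArg (Int.cast : ℤ → ℚ) (hmn i)
      push_cast at this
      linear_combination e i * this
    rw [Finset.sum_congr rfl fun i _ => this i, ← Finset.mul_sum, Finset.sum_range]
    simp only [hk', hek, mul_zero]
  refine ⟨m, n, ?_, Prod.ext ?_ (Prod.ext ?_ ?_)⟩
  · by_contra! hcon
    refine hk (funext fun i => ?_)
    have h1 := hcon i i.2
    have h2 := hmn i
    rw [hk', h1] at h2
    simp only [Pi.zero_apply]
    omega
  · rw [tword_fst, tword_fst, hpow]
  · refine mul_left_cancel₀ hX0 ?_
    rw [he, he, hpow, hlin]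
  · rw [tword_snd_snd, tword_snd_snd, ← hX, hpow]

/-- A kernel vector must annihilate `e` and, unless `X.1 ^ 2 = 1`, also have sum zero: two equations
need three unknowns, one equation needs two. -/
theorem exists_tripleCollision_of_eq {X : ℚ × ℚ × ℚ} {Z : ℕ → ℚ × ℚ × ℚ} {t : ℕ}
    (hZ : ∀ i, (Z i).1 ≠ 0 ∧ (Z i).2.2 ≠ 0) (hX : X.1 = X.2.2) (hX0 : X.1 ≠ 0)
    (ht : 3 ≤ t ∨ 2 ≤ t ∧ X.1 ^ 2 = 1) :
    ∃ m n, TripleCollision X Z t m n := by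
  obtain ⟨c, e, -, he⟩ := exists_linear_tword X hX Z hZ t
  rcases ht with ht | ⟨ht, h1⟩
  · obtain ⟨k, hk0, hk⟩ := exists_int_kernel_vector (r := 2) (by omega) (by omega)
      (fun i (j : Fin t) => if i = 0 then e j else 1)
    refine exists_tripleCollision_of_kernel hX hX0 he k hk0 (by simpa using hk 0) (Or.inr ?_)
    have := hk 1
    simp only [one_ne_zero, if_false, one_mul] at this
    exact_mod_cast this
  · obtain ⟨k, hk0, hk⟩ := exists_int_kernel_vector (r := 1) (by omega) (by omega)
      (fun _ (j : Fin t) => e j)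
    exact exists_tripleCollision_of_kernel hX hX0 he k hk0 (hk 0) (Or.inl h1)

theorem tword_congr {K : Type*} [CommRing K] (X : K × K × K) (Z : ℕ → K × K × K) (m n : ℕ → ℕ)
    (k : ℕ) (h : ∀ i < k, tpow X (m i) = tpow X (n i)) : tword X Z m k = tword X Z n k := by
  induction k with
  | zero => rfl
  | succ k ih => rw [tword, tword, ih fun i hi => h i (by omega), h k (by omega)]

theorem exists_tripleCollision_of_tpow_eq {X : ℚ × ℚ × ℚ} (Z : ℕ → ℚ × ℚ × ℚ) {t : ℕ}
    (ht : 1 ≤ t) {u v : ℕ} (huv : u ≠ v) (h : tpow X u = tpow X v) :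
    ∃ m n, TripleCollision X Z t m n :=
  ⟨fun _ => u, fun _ => v, ⟨0, ht, huv⟩, tword_congr _ _ _ _ _ fun _ _ => h⟩

/-- The rationals `0`, `1` and `-1`, whose powers are not pairwise distinct. -/
def IsTorsion (q : ℚ) : Prop := q = 0 ∨ q = 1 ∨ q = -1

theorem tpow_three_eq_or {X : ℚ × ℚ × ℚ} (h1 : IsTorsion X.1) (h2 : IsTorsion X.2.2)
    (h : X.1 ≠ X.2.2 ∨ X.2.1 = 0 ∨ X.1 = 0) :
    tpow X 3 = tpow X 1 ∨ tpow X 3 = tpow X 2 := by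
  obtain ⟨a, b, d⟩ := X
  simp only [tpow, tmul, Prod.mk.injEq]
  simp only at h h1 h2
  rcases h1 with rfl | rfl | rfl <;> rcases h2 with rfl | rfl | rfl <;> norm_num at h ⊢ <;>
    simp [h]

theorem exists_tripleCollision_of_isTorsion {X : ℚ × ℚ × ℚ} {Z : ℕ → ℚ × ℚ × ℚ} {t : ℕ}
    (ht : 1 ≤ t) (hZ : ∀ i, (Z i).1 ≠ 0 ∧ (Z i).2.2 ≠ 0) (h1 : IsTorsion X.1)
    (h2 : IsTorsion X.2.2) (h : 2 ≤ t ∨ X.1 ≠ X.2.2 ∨ X.2.1 = 0 ∨ X.1 = 0) :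
    ∃ m n, TripleCollision X Z t m n := by
  by_cases h' : X.1 ≠ X.2.2 ∨ X.2.1 = 0 ∨ X.1 = 0
  · rcases tpow_three_eq_or h1 h2 h' with h3 | h3
    · exact exists_tripleCollision_of_tpow_eq Z ht (by norm_num) h3
    · exact exists_tripleCollision_of_tpow_eq Z ht (by norm_num) h3
  · have ht2 := h.resolve_right h'
    push Not at h'
    refine exists_tripleCollision_of_eq hZ h'.1 h'.2.2 (Or.inr ⟨ht2, ?_⟩)
    rcases h1 with h1 | h1 | h1
    · exact absurd h1 h'.2.2
    · rw [h1]; norm_num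
    · rw [h1]; norm_num

/-- With a single exponent the affine function is injective, since its slope is nonzero. -/
theorem not_tripleCollision_one {X : ℚ × ℚ × ℚ} {Z : ℕ → ℚ × ℚ × ℚ} {m n : ℕ → ℕ}
    (hZ : ∀ i, (Z i).1 ≠ 0 ∧ (Z i).2.2 ≠ 0) (hX : X.1 = X.2.2) (hX0 : X.1 ≠ 0)
    (hb : X.2.1 ≠ 0) : ¬ TripleCollision X Z 1 m n := by
  rintro ⟨⟨i, hi, hne⟩, h⟩
  obtain rfl : i = 0 := by omega
  obtain ⟨c, e, he0, he⟩ := exists_linear_tword X hX Z hZ 1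
  have h1 := (pow_sum_eq_of_tword_eq hZ h).1
  have h2 := he m
  rw [h, he n, h1] at h2
  have h3 := mul_left_cancel₀ hb (add_left_cancel (mul_left_cancel₀ (pow_ne_zero _ hX0) h2))
  simp only [Finset.sum_range_one] at h3
  exact hne (Nat.cast_injective (R := ℚ) (mul_left_cancel₀ (he0 0) h3)).symm

theorem balancedCollision_iff_expCollision {X : ℤ × ℤ × ℤ} (Z : ℕ → ℤ × ℤ × ℤ)
    (hX : X.1 ≠ X.2.2) (t : ℕ) (m n : ℕ → ℕ) :
    BalancedCollision X Z t m n ↔ ExpCollision (expCoef X Z t) X.1 X.2.2 t m n := by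
  rw [BalancedCollision, ExpCollision, ← offDiag_tword, ← offDiag_tword]
  refine and_congr_right fun _ => and_congr_right fun hsum => ?_
  rw [offDiag, offDiag, tword_fst, tword_fst, tword_snd_snd, tword_snd_snd, hsum,
    add_left_inj]
  exact (mul_left_inj' (sub_ne_zero.2 hX.symm)).symm

theorem BalancedCollision.two_le {X : ℤ × ℤ × ℤ} {Z : ℕ → ℤ × ℤ × ℤ} {t : ℕ} {m n : ℕ → ℕ}
    (h : BalancedCollision X Z t m n) : 2 ≤ t := by
  obtain ⟨⟨i, hi, hne⟩, hsum, -⟩ := h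
  by_contra hlt
  obtain rfl : t = 1 := by omega
  obtain rfl : i = 0 := by omega
  exact hne (by simpa using hsum)

/-- The exponent vector `(u, v, 0, 0, …)`. -/
def twoExp (u v : ℕ) (i : ℕ) : ℕ := if i = 0 then u else if i = 1 then v else 0

theorem sum_range_twoExp (u v i : ℕ) : ∑ j ∈ Finset.range (i + 2), twoExp u v j = u + v := by
  rw [Finset.sum_range_succ', Finset.sum_range_succ']
  simp [twoExp, add_comm]

/-- The partial sums are 0, 1, 4, 4, … and 0, 3, 4, 4, …, so only the term with coefficient `c 1`
differs. -/
theorem expCollision_twoExp {c : ℕ → ℤ} {U V : ℤ} {t : ℕ} (ht : 2 ≤ t)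
    (hUV : U * V ^ 3 = U ^ 3 * V) : ExpCollision c U V t (twoExp 1 3) (twoExp 3 1) := by
  obtain ⟨t, rfl⟩ := Nat.exists_eq_add_of_le' ht
  refine ⟨⟨0, by omega, by simp [twoExp]⟩, by rw [sum_range_twoExp, sum_range_twoExp], ?_⟩
  refine Finset.sum_congr rfl fun i _ => ?_
  rw [sum_range_twoExp, sum_range_twoExp]
  match i with
  | 0 => simp
  | 1 =>
    simp only [Finset.sum_range_one, twoExp, if_pos]
    norm_num
    linear_combination c 1 * hUV
  | i + 2 => rw [sum_range_twoExp, sum_range_twoExp]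

/-- Given equal sums, a collision says `X.2.1 * (e 0 - e 1) * (m 0 - n 0) = 0`. As `m 0 ≠ n 0`, the
remaining factor vanishes, and then every balanced pair collides. -/
theorem BalancedCollision.twoExp_of_eq {X : ℤ × ℤ × ℤ} {Z : ℕ → ℤ × ℤ × ℤ} {m n : ℕ → ℕ}
    (h : BalancedCollision X Z 2 m n) (hX : X.1 = X.2.2) (hX0 : X.1 ≠ 0)
    (hZ : ∀ i, (Z i).1 ≠ 0 ∧ (Z i).2.2 ≠ 0) :
    BalancedCollision X Z 2 (twoExp 1 3) (twoExp 3 1) := by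
  obtain ⟨⟨i, hi, hne⟩, hsum, hQ⟩ := h
  obtain ⟨c, e, -, he⟩ := exists_linear_tword X hX Z hZ 2
  have hne0 : (m 0 : ℤ) - n 0 ≠ 0 := by
    simp only [Finset.sum_range_succ, Finset.sum_range_zero] at hsum
    have : i = 0 ∨ i = 1 := by omega
    rcases this with rfl | rfl <;> omega
  have h1 := he m
  rw [hQ, he n, hsum] at h1
  have h2 := add_left_cancel (mul_left_cancel₀ (pow_ne_zero _ hX0) h1)
  have hsum' : (m 0 : ℤ) + m 1 = n 0 + n 1 := by
    simp only [Finset.sum_range_succ, Finset.sum_range_zero] at hsum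
    omega
  simp only [Finset.sum_range_succ, Finset.sum_range_zero, zero_add] at h2
  have h3 : X.2.1 * (e 0 - e 1) = 0 := by
    refine ((mul_eq_zero (b := (m 0 : ℤ) - (n 0 : ℤ))).1 ?_).resolve_right hne0
    linear_combination -h2 - X.2.1 * e 1 * hsum'
  refine ⟨⟨0, by omega, by simp [twoExp]⟩,
    by rw [sum_range_twoExp 1 3 0, sum_range_twoExp 3 1 0], ?_⟩
  refine mul_left_cancel₀ hX0 ?_
  rw [he, he, sum_range_twoExp 1 3 0, sum_range_twoExp 3 1 0]
  simp only [Finset.sum_range_succ, Finset.sum_range_zero, zero_add, twoExp, if_true,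
    one_ne_zero, if_false]
  push_cast
  linear_combination (-2 * X.1 ^ (3 + 1)) * h3

/-! ### The search bound. -/

/-- A common bound for the entries of a triple. -/
def tripleSize (A : ℤ × ℤ × ℤ) : ℕ := A.1.natAbs + A.2.1.natAbs + A.2.2.natAbs

def totalSize (X : ℤ × ℤ × ℤ) (Z : ℕ → ℤ × ℤ × ℤ) : ℕ → ℕ
  | 0 => tripleSize X
  | k + 1 => totalSize X Z k + tripleSize (Z k)

theorem tripleSize_le_totalSize (X : ℤ × ℤ × ℤ) (Z : ℕ → ℤ × ℤ × ℤ) (k : ℕ) :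
    tripleSize X ≤ totalSize X Z k ∧ ∀ i < k, tripleSize (Z i) ≤ totalSize X Z k := by
  induction k with
  | zero => exact ⟨le_rfl, fun i hi => absurd hi (Nat.not_lt_zero i)⟩
  | succ k ih =>
    rw [totalSize]
    refine ⟨by omega, fun i hi => ?_⟩
    rcases Nat.lt_succ_iff_lt_or_eq.1 hi with h | rfl
    · have := ih.2 i h
      omega
    · omega

/-- Balanced collisions can be searched for among exponents below this bound. -/
def searchBound (t : ℕ) (X : ℤ × ℤ × ℤ) (Z : ℕ → ℤ × ℤ × ℤ) : ℕ :=
  gapBound (2 * ((t + 1) * (4 * totalSize X Z (t + 1) ^ (t + 2)))) (totalSize X Z (t + 1))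
    (2 * t + 3) + 4

theorem BalancedCollision.exists_bounded {X : ℤ × ℤ × ℤ} {Z : ℕ → ℤ × ℤ × ℤ} {t : ℕ}
    {m n : ℕ → ℕ} (h : BalancedCollision X Z t m n) (hX0 : X.1 ≠ 0 ∨ X.2.2 ≠ 0)
    (hZ : ∀ i, (Z i).1 ≠ 0 ∧ (Z i).2.2 ≠ 0) (ht : ¬ (3 ≤ t ∧ X.1 = X.2.2)) :
    ∃ m' n', BalancedCollision X Z t m' n' ∧
      ∀ i < t, m' i < searchBound t X Z ∧ n' i < searchBound t X Z := by
  have ht2 := h.two_le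
  have htwo : ∀ i, twoExp 1 3 i < searchBound t X Z ∧ twoExp 3 1 i < searchBound t X Z := by
    intro i
    simp only [twoExp, searchBound]
    split_ifs <;> omega
  by_cases hX : X.1 = X.2.2
  · obtain rfl : t = 2 := by
      by_contra hne
      exact ht ⟨by omega, hX⟩
    exact ⟨_, _, h.twoExp_of_eq hX (by rcases hX0 with h0 | h0 <;> simpa [hX] using h0) hZ,
      fun i _ => htwo i⟩
  -- The equation reads $UV(V-U)(V+U)=0$; it covers a zero entry and $U=-V$ at once. The summand 4
  -- in `searchBound` makes room for the exponents 1 and 3.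
  by_cases hdeg : X.1 * X.2.2 ^ 3 = X.1 ^ 3 * X.2.2
  · exact ⟨_, _, (balancedCollision_iff_expCollision Z hX t _ _).2 (expCollision_twoExp ht2 hdeg),
      fun i _ => htwo i⟩
  have hU : X.1 ≠ 0 := fun h0 => hdeg (by rw [h0]; ring)
  have hV : X.2.2 ≠ 0 := fun h0 => hdeg (by rw [h0]; ring)
  have hUV : X.1.natAbs ≠ X.2.2.natAbs := by
    intro habs
    rcases Int.natAbs_eq_natAbs_iff.1 habs with h0 | h0
    · exact hX h0
    · exact hdeg (by rw [h0]; ring)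
  obtain ⟨hXT, hZT⟩ := tripleSize_le_totalSize X Z (t + 1)
  set T := totalSize X Z (t + 1) with hT
  have hcoef := natAbs_expCoef_le X Z T t
    (by simp only [tripleSize] at hXT; omega)
    (fun i hi => by
      have := hZT i (by omega)
      simp only [tripleSize] at this
      omega)
  obtain ⟨m', n', h', hle⟩ :=
    ((balancedCollision_iff_expCollision Z hX t m n).1 h).exists_bounded hUV hU hV
      (C := 2 * ((t + 1) * (4 * T ^ (t + 2)))) (M := T)
      (by simp only [tripleSize] at hXT; omega) (by simp only [tripleSize] at hXT; omega)
      (Nat.mul_le_mul_left _ ((Finset.sum_le_card_nsmul _ _ _ fun i _ => hcoef i).trans_eq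
        (by simp)))
  refine ⟨m', n', (balancedCollision_iff_expCollision Z hX t _ _).2 h', fun i hi => ?_⟩
  have hsingle : ∀ f : ℕ → ℕ, f i ≤ ∑ j ∈ Finset.range t, f j := fun f =>
    Finset.single_le_sum (f := f) (fun _ _ => Nat.zero_le _) (Finset.mem_range.2 hi)
  have h1 := hsingle m'
  have h2 := hsingle n'
  have h3 := h'.2.1
  rw [searchBound, ← hT]
  omega

/-! ### Primitive recursiveness of the ingredients. -/

theorem PrimrecPred.const {α : Type*} [Primcodable α] (p : Prop) : PrimrecPred fun _ : α => p := by
  classical exact ⟨fun _ => inferInstance, Primrec.const _⟩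

namespace Primrec

/-- The encoding of `ℤ` sends `n` to `2 * n` and `-(n + 1)` to `2 * n + 1`. Addition and
multiplication reduce to `ℕ` by writing `z` as `z.toNat - (-z).toNat`. -/
theorem int_ofNat_sub_ofNat : Primrec₂ fun m n : ℕ => (m : ℤ) - n := by
  refine Primrec₂.encode_iff.1 ?_
  have : Primrec₂ fun m n : ℕ => if n ≤ m then 2 * (m - n) else 2 * (n - m - 1) + 1 :=
    Primrec.ite (nat_le.comp snd fst) (nat_double.comp (nat_sub.comp fst snd))
      (nat_double_succ.comp (nat_sub.comp (nat_sub.comp snd fst) (const 1)))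
  refine this.of_eq fun m n => ?_
  split_ifs with h
  · obtain ⟨d, rfl⟩ := Nat.exists_eq_add_of_le h
    rw [Nat.add_sub_cancel_left, show ((n + d : ℕ) : ℤ) - n = Int.ofNat d by simp]
    rfl
  · obtain ⟨d, rfl⟩ := Nat.exists_eq_add_of_lt (not_le.1 h)
    rw [show (m : ℤ) - ((m + d + 1 : ℕ) : ℤ) = Int.negSucc d by
      rw [Int.negSucc_eq]; push_cast; ring, show m + d + 1 - m - 1 = d by omega]
    rfl

theorem int_toNat : Primrec Int.toNat := by
  have : Primrec fun z : ℤ =>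
      if Nat.bodd (Encodable.encode z) = true then 0 else Nat.div2 (Encodable.encode z) :=
    Primrec.ite (Primrec.eq.comp (nat_bodd.comp Primrec.encode) (const true)) (const 0)
      (nat_div2.comp Primrec.encode)
  refine this.of_eq fun z => ?_
  cases z with
  | ofNat n =>
    rw [show Encodable.encode (Int.ofNat n) = 2 * n from rfl]
    simp
  | negSucc n =>
    rw [show Encodable.encode (Int.negSucc n) = 2 * n + 1 from rfl]
    simp

theorem int_neg : Primrec fun z : ℤ => -z := by
  have : Primrec fun z : ℤ =>
      if Nat.bodd (Encodable.encode z) = true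
      then ((Nat.div2 (Encodable.encode z) + 1 : ℕ) : ℤ) - (0 : ℕ)
      else ((0 : ℕ) : ℤ) - (Nat.div2 (Encodable.encode z) : ℕ) :=
    Primrec.ite (Primrec.eq.comp (nat_bodd.comp Primrec.encode) (const true))
      (int_ofNat_sub_ofNat.comp (succ.comp (nat_div2.comp Primrec.encode)) (const 0))
      (int_ofNat_sub_ofNat.comp (const 0) (nat_div2.comp Primrec.encode))
  refine this.of_eq fun z => ?_
  cases z with
  | ofNat n =>
    rw [show Encodable.encode (Int.ofNat n) = 2 * n from rfl]
    simp
  | negSucc n =>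
    rw [show Encodable.encode (Int.negSucc n) = 2 * n + 1 from rfl]
    simp

theorem int_natCast : Primrec fun n : ℕ => (n : ℤ) :=
  (int_ofNat_sub_ofNat.comp Primrec.id (const 0)).of_eq fun n => by simp

theorem int_natAbs : Primrec Int.natAbs :=
  (nat_add.comp int_toNat (int_toNat.comp int_neg)).of_eq fun z => by omega

theorem int_add : Primrec₂ fun a b : ℤ => a + b :=
  (int_ofNat_sub_ofNat.comp
    (nat_add.comp (int_toNat.comp fst) (int_toNat.comp snd))
    (nat_add.comp (int_toNat.comp (int_neg.comp fst)) (int_toNat.comp (int_neg.comp snd)))).of_eq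
    fun p => by
      push_cast
      omega

theorem int_mul : Primrec₂ fun a b : ℤ => a * b :=
  (int_ofNat_sub_ofNat.comp
    (nat_add.comp (nat_mul.comp (int_toNat.comp fst) (int_toNat.comp snd))
      (nat_mul.comp (int_toNat.comp (int_neg.comp fst)) (int_toNat.comp (int_neg.comp snd))))
    (nat_add.comp (nat_mul.comp (int_toNat.comp fst) (int_toNat.comp (int_neg.comp snd)))
      (nat_mul.comp (int_toNat.comp (int_neg.comp fst)) (int_toNat.comp snd)))).of_eq
    fun ⟨a, b⟩ => by
      dsimp only
      have ha := Int.toNat_sub_toNat_neg a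
      have hb := Int.toNat_sub_toNat_neg b
      conv_rhs => rw [← ha, ← hb]
      push_cast
      ring

theorem nat_pow : Primrec₂ fun a b : ℕ => a ^ b :=
  Primrec₂.unpaired'.1 Nat.Primrec.pow

theorem tmul : Primrec₂ (tmul : ℤ × ℤ × ℤ → ℤ × ℤ × ℤ → ℤ × ℤ × ℤ) :=
  pair (int_mul.comp (fst.comp fst) (fst.comp snd))
    (pair
      (int_add.comp (int_mul.comp (fst.comp fst) (fst.comp (snd.comp snd)))
        (int_mul.comp (fst.comp (snd.comp fst)) (snd.comp (snd.comp snd))))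
      (int_mul.comp (snd.comp (snd.comp fst)) (snd.comp (snd.comp snd))))

theorem tpow : Primrec₂ (tpow : ℤ × ℤ × ℤ → ℕ → ℤ × ℤ × ℤ) := by
  refine Primrec₂.of_eq (nat_rec (f := fun _ : ℤ × ℤ × ℤ => ((1, 0, 1) : ℤ × ℤ × ℤ))
    (g := fun X p => _root_.tmul p.2 X) (const _) (tmul.comp (snd.comp snd) fst)) fun X k => ?_
  induction k with
  | zero => rfl
  | succ k ih => exact congrArg (fun A => _root_.tmul A X) ih

variable {α : Type*} [Primcodable α]

theorem tword {X : α → ℤ × ℤ × ℤ} {Z : ℕ → α → ℤ × ℤ × ℤ} {m : ℕ → α → ℕ} (hX : Primrec X)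
    (hZ : ∀ i, Primrec (Z i)) (hm : ∀ i, Primrec (m i)) (k : ℕ) :
    Primrec fun a => tword (X a) (fun i => Z i a) (fun i => m i a) k := by
  induction k with
  | zero => exact hZ 0
  | succ k ih => exact tmul.comp (tmul.comp ih (tpow.comp hX (hm k))) (hZ (k + 1))

theorem sum_range {m : ℕ → α → ℕ} (hm : ∀ i, Primrec (m i)) (k : ℕ) :
    Primrec fun a => ∑ i ∈ Finset.range k, m i a := by
  induction k with
  | zero => simpa using const 0
  | succ k ih =>
    simp only [Finset.sum_range_succ]
    exact nat_add.comp ih (hm k)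

theorem exists_lt_ne {m n : ℕ → α → ℕ} (hm : ∀ i, Primrec (m i)) (hn : ∀ i, Primrec (n i))
    (k : ℕ) : PrimrecPred fun a => ∃ i < k, m i a ≠ n i a := by
  induction k with
  | zero => exact (PrimrecPred.const False).of_eq fun a => by simp
  | succ k ih =>
    refine (ih.or (Primrec.eq.comp (hm k) (hn k)).not).of_eq fun a => ?_
    rw [Nat.exists_lt_succ_right]

theorem tripleSize : Primrec tripleSize :=
  nat_add.comp (nat_add.comp (int_natAbs.comp fst) (int_natAbs.comp (fst.comp snd)))
    (int_natAbs.comp (snd.comp snd))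

theorem totalSize {X : α → ℤ × ℤ × ℤ} {Z : ℕ → α → ℤ × ℤ × ℤ} (hX : Primrec X)
    (hZ : ∀ i, Primrec (Z i)) (k : ℕ) :
    Primrec fun a => totalSize (X a) (fun i => Z i a) k := by
  induction k with
  | zero => exact tripleSize.comp hX
  | succ k ih => exact nat_add.comp ih (tripleSize.comp (hZ k))

theorem gapBound {C M : α → ℕ} (hC : Primrec C) (hM : Primrec M) (k : ℕ) :
    Primrec fun a => gapBound (C a) (M a) k := by
  induction k with
  | zero => exact const 0
  | succ k ih => exact succ.comp (nat_add.comp ih (nat_mul.comp hC (nat_pow.comp hM (succ.comp ih))))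

theorem searchBound {X : α → ℤ × ℤ × ℤ} {Z : ℕ → α → ℤ × ℤ × ℤ} (hX : Primrec X)
    (hZ : ∀ i, Primrec (Z i)) (t : ℕ) :
    Primrec fun a => searchBound t (X a) (fun i => Z i a) := by
  have hT := totalSize hX hZ (t + 1)
  exact nat_add.comp (gapBound (nat_mul.comp (const 2) (nat_mul.comp (const (t + 1))
    (nat_mul.comp (const 4) (nat_pow.comp hT (const (t + 2)))))) hT (2 * t + 3)) (const 4)

theorem balancedCollision {X : α → ℤ × ℤ × ℤ} {Z : ℕ → α → ℤ × ℤ × ℤ} {m n : ℕ → α → ℕ}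
    (hX : Primrec X) (hZ : ∀ i, Primrec (Z i)) (hm : ∀ i, Primrec (m i))
    (hn : ∀ i, Primrec (n i)) (t : ℕ) :
    PrimrecPred fun a =>
      BalancedCollision (X a) (fun i => Z i a) t (fun i => m i a) (fun i => n i a) :=
  (exists_lt_ne hm hn t).and ((Primrec.eq.comp (sum_range hm t) (sum_range hn t)).and
    (Primrec.eq.comp (fst.comp (snd.comp (tword hX hZ hm t)))
      (fst.comp (snd.comp (tword hX hZ hn t)))))

end Primrec

/-! ### The decision procedure on codes. -/

/-- An integer multiple of the matrix with the given code. -/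
def scaledMat (c : MatCode) : ℤ × ℤ × ℤ :=
  (c.1.1 * (c.2.1.2 * c.2.2.2 : ℕ), c.2.1.1 * (c.1.2 * c.2.2.2 : ℕ),
    c.2.2.1 * (c.1.2 * c.2.1.2 : ℕ))

theorem Primrec.scaledMat : Primrec scaledMat := by
  have h1 : Primrec fun c : MatCode => c.1 := Primrec.fst
  have h2 : Primrec fun c : MatCode => c.2.1 := Primrec.fst.comp Primrec.snd
  have h3 : Primrec fun c : MatCode => c.2.2 := Primrec.snd.comp Primrec.snd
  have hmul : ∀ {p q r : MatCode → RatCode}, Primrec p → Primrec q → Primrec r →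
      Primrec fun c => (p c).1 * (((q c).2 * (r c).2 : ℕ) : ℤ) := fun hp hq hr =>
    Primrec.int_mul.comp (Primrec.fst.comp hp) (Primrec.int_natCast.comp
      (Primrec.nat_mul.comp (Primrec.snd.comp hq) (Primrec.snd.comp hr)))
  exact Primrec.pair (hmul h1 h2 h3) (Primrec.pair (hmul h2 h1 h3) (hmul h3 h1 h2))

/-- The `i`-th matrix of a list of codes, scaled; the identity matrix beyond the end. -/
def scaledEntry (l : List MatCode) (i : ℕ) : ℤ × ℤ × ℤ :=
  scaledMat (l.getD i ((1, 1), (0, 1), (1, 1)))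

/-- The code of a rational number with repeating powers. -/
def IsTorsionCode (q : RatCode) : Prop := q.1.natAbs ≤ 1 ∧ q.2 = 1

/-- The `i`-th digit of `p` in base `B`. -/
def digit (B i p : ℕ) : ℕ := p / B ^ i % B

/-- `p` encodes a balanced collision with exponents below the search bound. -/
def EncodesCollision (t p : ℕ) (c : MatCode × List MatCode) : Prop :=
  BalancedCollision (scaledMat c.1) (scaledEntry c.2) t
    (fun i => digit (searchBound t (scaledMat c.1) (scaledEntry c.2)) i p)
    (fun i => digit (searchBound t (scaledMat c.1) (scaledEntry c.2)) (t + i) p)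

/-- The codes of the morphisms that are not injective because of the powers of the image of `x`. -/
def IsDegenerateCode (t : ℕ) (c : MatCode) : Prop :=
  (IsTorsionCode c.1 ∧ IsTorsionCode c.2.2 ∧
    (2 ≤ t ∨ c.1 ≠ c.2.2 ∨ c.2.1.1 = 0 ∨ c.1.1 = 0)) ∨ (3 ≤ t ∧ c.1 = c.2.2)

/-- The codes of the morphisms that are not injective. -/
def IsNoninjectiveCode (t : ℕ) (c : MatCode × List MatCode) : Prop :=
  IsDegenerateCode t c.1 ∨
    ∃ p < searchBound t (scaledMat c.1) (scaledEntry c.2) ^ (2 * t), EncodesCollision t p c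

theorem primrecPred_isTorsionCode : PrimrecPred IsTorsionCode :=
  (Primrec.nat_le.comp (Primrec.int_natAbs.comp Primrec.fst) (Primrec.const 1)).and
    (Primrec.eq.comp Primrec.snd (Primrec.const 1))

theorem primrecPred_isDegenerateCode (t : ℕ) : PrimrecPred (IsDegenerateCode t) := by
  have ha : Primrec fun c : MatCode => c.1 := Primrec.fst
  have hb : Primrec fun c : MatCode => c.2.1.1 :=
    Primrec.fst.comp (Primrec.fst.comp Primrec.snd)
  have hd : Primrec fun c : MatCode => c.2.2 := Primrec.snd.comp Primrec.snd
  have had : PrimrecPred fun c : MatCode => c.1 = c.2.2 := Primrec.eq.comp ha hd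
  have hb0 : PrimrecPred fun c : MatCode => c.2.1.1 = 0 := Primrec.eq.comp hb (Primrec.const 0)
  have ha0 : PrimrecPred fun c : MatCode => c.1.1 = 0 :=
    Primrec.eq.comp (Primrec.fst.comp ha) (Primrec.const 0)
  exact ((primrecPred_isTorsionCode.comp ha).and ((primrecPred_isTorsionCode.comp hd).and
    ((PrimrecPred.const _).or (had.not.or (hb0.or ha0))))).or ((PrimrecPred.const _).and had)

theorem primrec_scaledEntry (i : ℕ) :
    Primrec fun c : MatCode × List MatCode => scaledEntry c.2 i :=
  Primrec.scaledMat.comp ((Primrec.list_getD _).comp Primrec.snd (Primrec.const i))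

theorem primrecRel_encodesCollision (t : ℕ) : PrimrecRel (EncodesCollision t) := by
  have hX : Primrec fun c : MatCode × List MatCode => scaledMat c.1 :=
    Primrec.scaledMat.comp Primrec.fst
  have hZ := primrec_scaledEntry
  have hB : Primrec fun q : ℕ × (MatCode × List MatCode) =>
      searchBound t (scaledMat q.2.1) (scaledEntry q.2.2) :=
    Primrec.searchBound (hX.comp Primrec.snd) (fun i => (hZ i).comp Primrec.snd) t
  have hdig : ∀ i, Primrec fun q : ℕ × (MatCode × List MatCode) =>
      digit (searchBound t (scaledMat q.2.1) (scaledEntry q.2.2)) i q.1 := fun i =>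
    Primrec.nat_mod.comp (Primrec.nat_div.comp Primrec.fst
      (Primrec.nat_pow.comp hB (Primrec.const i))) hB
  exact Primrec.balancedCollision (hX.comp Primrec.snd) (fun i => (hZ i).comp Primrec.snd) hdig
      (fun i => hdig (t + i)) t

theorem primrecPred_isNoninjectiveCode (t : ℕ) : PrimrecPred (IsNoninjectiveCode t) := by
  have hB : Primrec fun c : MatCode × List MatCode =>
      searchBound t (scaledMat c.1) (scaledEntry c.2) :=
    Primrec.searchBound (Primrec.scaledMat.comp Primrec.fst) primrec_scaledEntry t
  have hlist : Primrec fun c : MatCode × List MatCode =>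
      List.range (searchBound t (scaledMat c.1) (scaledEntry c.2) ^ (2 * t)) :=
    Primrec.list_range.comp (Primrec.nat_pow.comp hB (Primrec.const (2 * t)))
  have hex := (primrecRel_encodesCollision t).exists_mem_list.comp hlist Primrec.id
  have hdeg : PrimrecPred fun c : MatCode × List MatCode => IsDegenerateCode t c.1 :=
    (primrecPred_isDegenerateCode t).comp Primrec.fst
  refine (hdeg.or hex).of_eq fun c => ?_
  simp only [List.mem_range, id_eq]
  rfl

theorem exists_digits {B N : ℕ} {f : ℕ → ℕ} (hf : ∀ i < N, f i < B) :
    ∃ p < B ^ N, ∀ i < N, digit B i p = f i := by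
  let g : Fin N → Fin B := fun i => ⟨f i, hf i i.2⟩
  refine ⟨finFunctionFinEquiv g, (finFunctionFinEquiv g).2, fun i hi => ?_⟩
  exact congrArg Fin.val (congrFun (finFunctionFinEquiv.symm_apply_apply g) ⟨i, hi⟩)

/-- Needed because the digits of a code `p` are prescribed only at the relevant positions. -/
theorem BalancedCollision.congr {X : ℤ × ℤ × ℤ} {Z : ℕ → ℤ × ℤ × ℤ} {t : ℕ}
    {m n m' n' : ℕ → ℕ} (h : BalancedCollision X Z t m n) (hm : ∀ i < t, m' i = m i)
    (hn : ∀ i < t, n' i = n i) : BalancedCollision X Z t m' n' := by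
  obtain ⟨⟨i, hi, hne⟩, hsum, hQ⟩ := h
  refine ⟨⟨i, hi, by rwa [hm i hi, hn i hi]⟩, ?_, ?_⟩
  · rw [Finset.sum_congr rfl fun i hi => hm i (Finset.mem_range.1 hi), hsum]
    exact (Finset.sum_congr rfl fun i hi => hn i (Finset.mem_range.1 hi)).symm
  · rw [tword_congr X Z m' m t fun i hi => by rw [hm i hi], hQ,
      tword_congr X Z n' n t fun i hi => by rw [hn i hi]]

/-! ### Correctness of the procedure for matrices. -/

/-- The entries (1,1), (1,2), (2,2) of an upper-triangular matrix. -/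
def UpperTri.entries (M : UpperTri) : ℚ × ℚ × ℚ := (M.1 0 0, M.1 0 1, M.1 1 1)

namespace UpperTri

theorem apply_one_zero (M : UpperTri) : M.1 1 0 = 0 :=
  (Matrix.mem_blockTriangularSubsemiring.1 M.2) (show (0 : Fin 2) < 1 by decide)

theorem entries_injective : Function.Injective entries := by
  intro M N h
  simp only [entries, Prod.mk.injEq] at h
  ext i j
  fin_cases i <;> fin_cases j
  · exact h.1
  · exact h.2.1
  · exact (apply_one_zero M).trans (apply_one_zero N).symm
  · exact h.2.2

theorem entries_mul (M N : UpperTri) : (M * N).entries = tmul M.entries N.entries := by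
  simp only [entries, tmul, MulMemClass.coe_mul, Matrix.mul_apply,
    Fin.sum_univ_two, apply_one_zero, mul_zero, zero_mul, add_zero, zero_add]

theorem entries_pow (M : UpperTri) (k : ℕ) : (M ^ k).entries = tpow M.entries k := by
  induction k with
  | zero => simp [entries, tpow]
  | succ k ih => rw [pow_succ, entries_mul, ih, tpow]

theorem entries_bword (x : UpperTri) (z : ℕ → UpperTri) (m : ℕ → ℕ) (k : ℕ) :
    (bword x z m k).entries = tword x.entries (fun i => (z i).entries) m k := by
  induction k with
  | zero => rfl
  | succ k ih => rw [bword, tword, entries_mul, entries_mul, entries_pow, ih]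

theorem entries_ne_zero {M : UpperTri} (h : M.1.det ≠ 0) :
    M.entries.1 ≠ 0 ∧ M.entries.2.2 ≠ 0 := by
  rw [Matrix.det_fin_two, apply_one_zero, mul_zero, sub_zero] at h
  exact mul_ne_zero_iff.1 h

end UpperTri

theorem scaledBy_scaledMat (M : UpperTri) :
    ∃ s : ℚ, s ≠ 0 ∧ ScaledBy s (scaledMat (matCode M)) M.entries := by
  have h0 : ∀ q : ℚ, (q.den : ℚ) ≠ 0 := fun q => Nat.cast_ne_zero.2 q.den_nz
  refine ⟨(M.1 0 0).den * (M.1 0 1).den * (M.1 1 1).den,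
    mul_ne_zero (mul_ne_zero (h0 _) (h0 _)) (h0 _), ?_⟩
  simp only [ScaledBy, scaledMat, matCode, ratCode, UpperTri.entries]
  push_cast
  rw [← Rat.mul_den_eq_num (M.1 0 0), ← Rat.mul_den_eq_num (M.1 0 1),
    ← Rat.mul_den_eq_num (M.1 1 1)]
  exact ⟨by ring, by ring, by ring⟩

theorem ratCode_injective : Function.Injective ratCode := fun _ _ h =>
  Rat.ext (congrArg Prod.fst h) (congrArg Prod.snd h)

theorem isTorsionCode_ratCode (q : ℚ) : IsTorsionCode (ratCode q) ↔ IsTorsion q := by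
  rw [IsTorsionCode, IsTorsion, ratCode]
  constructor
  · rintro ⟨h1, h2⟩
    have hq : (q.num : ℚ) = q := Rat.coe_int_num_of_den_eq_one h2
    have : q.num = 0 ∨ q.num = 1 ∨ q.num = -1 := by omega
    rcases this with h | h | h <;> rw [← hq, h] <;> simp
  · rintro (rfl | rfl | rfl) <;> simp

theorem abs_ne_one_of_not_isTorsion {q : ℚ} (h : ¬ IsTorsion q) : q ≠ 0 ∧ |q| ≠ 1 := by
  rw [IsTorsion] at h
  push Not at h
  refine ⟨h.1, fun h1 => ?_⟩
  rcases (abs_eq zero_le_one).1 h1 with h2 | h2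
  · exact h.2.1 h2
  · exact h.2.2 h2

theorem isNoninjectiveCode_iff {t : ℕ} (ht : 1 ≤ t) {x : UpperTri} {z : ℕ → UpperTri}
    (hz : ∀ i, (z i).1.det ≠ 0) {l : List MatCode}
    (hl : ∀ i, scaledEntry l i = scaledMat (matCode (z i))) :
    IsNoninjectiveCode t (matCode x, l) ↔
      ∃ m n, TripleCollision x.entries (fun i => (z i).entries) t m n := by
  have hZ : ∀ i, (z i).entries.1 ≠ 0 ∧ (z i).entries.2.2 ≠ 0 := fun i =>
    UpperTri.entries_ne_zero (hz i)
  obtain ⟨s, hs, hx⟩ := scaledBy_scaledMat x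
  choose s' hs' hz' using fun i => scaledBy_scaledMat (z i)
  have hbal := balancedCollision_iff hs hs' hx hz' t
  have hZ' : ∀ i, (scaledMat (matCode (z i))).1 ≠ 0 ∧ (scaledMat (matCode (z i))).2.2 ≠ 0 := by
    intro i
    rw [← Int.cast_ne_zero (α := ℚ), ← Int.cast_ne_zero (α := ℚ), (hz' i).1, (hz' i).2.2]
    exact ⟨mul_ne_zero (hs' i) (hZ i).1, mul_ne_zero (hs' i) (hZ i).2⟩
  have hdiag : (scaledMat (matCode x)).1 = (scaledMat (matCode x)).2.2 ↔
      x.entries.1 = x.entries.2.2 := by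
    rw [← Int.cast_inj (α := ℚ), hx.1, hx.2.2, mul_right_inj' hs]
  have hdeg : IsDegenerateCode t (matCode x) ↔
      (IsTorsion x.entries.1 ∧ IsTorsion x.entries.2.2 ∧ (2 ≤ t ∨
        x.entries.1 ≠ x.entries.2.2 ∨ x.entries.2.1 = 0 ∨ x.entries.1 = 0)) ∨
      (3 ≤ t ∧ x.entries.1 = x.entries.2.2) := by
    have hnum : ∀ q : ℚ, (ratCode q).1 = 0 ↔ q = 0 := fun q => Rat.num_eq_zero
    simp only [IsDegenerateCode, matCode, isTorsionCode_ratCode, ratCode_injective.eq_iff,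
      hnum, UpperTri.entries, ne_eq]
  have hentry : scaledEntry l = fun i => scaledMat (matCode (z i)) := funext hl
  rw [IsNoninjectiveCode, hdeg]
  dsimp only
  simp only [EncodesCollision, hentry]
  set X := scaledMat (matCode x)
  set Z := fun i => scaledMat (matCode (z i))
  constructor
  · rintro ((⟨h1, h2, h3⟩ | ⟨h1, h2⟩) | ⟨p, -, hp⟩)
    · exact exists_tripleCollision_of_isTorsion ht hZ h1 h2 h3
    · by_cases h0 : x.entries.1 = 0
      · exact exists_tripleCollision_of_isTorsion ht hZ (Or.inl h0) (Or.inl (h2 ▸ h0))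
          (Or.inl (by omega))
      · exact exists_tripleCollision_of_eq hZ h2 h0 (Or.inl h1)
    · exact ⟨_, _, ((hbal _ _).1 hp).1⟩
  · rintro ⟨m, n, h⟩
    by_contra hcon
    push Not at hcon
    obtain ⟨hcon, hsearch⟩ := hcon
    by_cases htor : IsTorsion x.entries.1 ∧ IsTorsion x.entries.2.2
    -- What the degenerate test leaves here is `t = 1` with equal nonzero diagonal entries and a
    -- nonzero off-diagonal one.
    · obtain ⟨ht2, hX, hb, hX0⟩ := hcon.1 htor.1 htor.2
      obtain rfl : t = 1 := by omega
      exact not_tripleCollision_one hZ hX hX0 hb h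
    · have htor' : x.entries.1 ≠ 0 ∧ |x.entries.1| ≠ 1 ∨
          x.entries.2.2 ≠ 0 ∧ |x.entries.2.2| ≠ 1 := by
        by_cases h1 : IsTorsion x.entries.1
        · exact Or.inr (abs_ne_one_of_not_isTorsion fun h2 => htor ⟨h1, h2⟩)
        · exact Or.inl (abs_ne_one_of_not_isTorsion h1)
      have hb := (hbal m n).2 ⟨h, h.sum_eq hZ htor'⟩
      have hX0 : X.1 ≠ 0 ∨ X.2.2 ≠ 0 := by
        rw [← Int.cast_ne_zero (α := ℚ), ← Int.cast_ne_zero (α := ℚ), hx.1, hx.2.2]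
        exact htor'.imp (fun h => mul_ne_zero hs h.1) (fun h => mul_ne_zero hs h.1)
      obtain ⟨m', n', h', hlt⟩ := hb.exists_bounded hX0 hZ'
        (fun h3 => hcon.2 h3.1 (hdiag.1 h3.2))
      -- One number carries both vectors: `m'` in the first `t` digits, `n'` in the next `t`.
      obtain ⟨p, hp, hdig⟩ := exists_digits (B := searchBound t X Z) (N := 2 * t)
        (f := fun i => if i < t then m' i else n' (i - t)) (fun i hi => by
          split_ifs with hit
          · exact (hlt i hit).1
          · exact (hlt (i - t) (by omega)).2)
      refine hsearch p hp (h'.congr (fun i hi => ?_) (fun i hi => ?_))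
      · rw [hdig i (by omega), if_pos hi]
      · rw [hdig (t + i) (by omega), if_neg (by omega), Nat.add_sub_cancel_left]

/-! ### Words of the language and the conclusion. -/

theorem bword_eq_mul_prod_ofFn {G : Type*} [Monoid G] (x : G) (z : ℕ → G) (m : ℕ → ℕ) (k : ℕ) :
    bword x z m k = z 0 * (List.ofFn fun i : Fin k => x ^ m i * z (i + 1)).prod := by
  induction k with
  | zero => simp [bword]
  | succ k ih =>
    rw [bword, ih, List.ofFn_succ_last, List.prod_append, List.prod_singleton]
    simp [mul_assoc]

/-- Comparing last letters strips trailing copies of `x` from both sides, and these must run out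
simultaneously. -/
theorem FreeMonoid.mul_of_mul_of_pow_eq {α : Type*} {a b x : α} (ha : a ≠ x) (hb : b ≠ x)
    {u v : FreeMonoid α} {p q : ℕ} (h : u * of a * of x ^ p = v * of b * of x ^ q) :
    p = q ∧ u * of a = v * of b := by
  have last : ∀ {u v : FreeMonoid α} {a b : α}, u * of a = v * of b → a = b := by
    intro u v a b h
    have h' := congrArg FreeMonoid.toList h
    simp only [FreeMonoid.toList_mul, FreeMonoid.toList_of] at h'
    simpa using (List.append_inj' h' rfl).2
  induction p generalizing q with
  | zero =>
    cases q with
    | zero => exact ⟨rfl, by simpa using h⟩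
    | succ q =>
      rw [pow_zero, mul_one, pow_succ, ← mul_assoc] at h
      exact absurd (last h) ha
  | succ p ih =>
    cases q with
    | zero =>
      rw [pow_zero, mul_one, pow_succ, ← mul_assoc] at h
      exact absurd (last h).symm hb
    | succ q =>
      rw [pow_succ, pow_succ, ← mul_assoc, ← mul_assoc] at h
      obtain ⟨h1, h2⟩ := ih (mul_right_cancel h)
      exact ⟨by rw [h1], h2⟩

theorem exists_bword_eq_mul {G : Type*} [Monoid G] (x : G) (z : ℕ → G) (m : ℕ → ℕ) (k : ℕ) :
    ∃ u, bword x z m k = u * z k := by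
  cases k with
  | zero => exact ⟨1, (one_mul _).symm⟩
  | succ k => exact ⟨_, rfl⟩

theorem eq_of_bword_eq_bword {α : Type*} {x : α} {z : ℕ → FreeMonoid α} {k : ℕ}
    (hz : ∀ i ≤ k, ∃ a ≠ x, z i = FreeMonoid.of a) {m n : ℕ → ℕ}
    (h : bword (FreeMonoid.of x) z m k = bword (FreeMonoid.of x) z n k) : ∀ i < k, m i = n i := by
  induction k with
  | zero => exact fun i hi => absurd hi (Nat.not_lt_zero i)
  | succ k ih =>
    rw [bword, bword] at h
    have h1 := mul_right_cancel h
    obtain ⟨u, hu⟩ := exists_bword_eq_mul (FreeMonoid.of x) z m k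
    obtain ⟨v, hv⟩ := exists_bword_eq_mul (FreeMonoid.of x) z n k
    obtain ⟨a, ha, hza⟩ := hz k (by omega)
    rw [hu, hv, hza] at h1
    obtain ⟨h2, h3⟩ := FreeMonoid.mul_of_mul_of_pow_eq ha ha h1
    rw [← hza, ← hu, ← hv] at h3
    intro i hi
    rcases Nat.lt_succ_iff_lt_or_eq.1 hi with hik | rfl
    · exact ih (fun i hi => hz i (by omega)) h3 i hik
    · exact h2

/-- The letters `z_i` as words, continued by the empty word. -/
def letterWord (t i : ℕ) : FreeMonoid (Letter t) :=
  if h : i < t + 1 then FreeMonoid.of (Letter.z ⟨i, h⟩) else 1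

theorem mem_boundedLang_iff {t : ℕ} {w : FreeMonoid (Letter t)} :
    w ∈ boundedLang t ↔
      ∃ m : ℕ → ℕ, w = bword (FreeMonoid.of Letter.x) (letterWord t) m t := by
  have key : ∀ m : ℕ → ℕ, bword (FreeMonoid.of Letter.x) (letterWord t) m t =
      FreeMonoid.of (Letter.z 0) * (List.ofFn fun i : Fin t =>
        FreeMonoid.of Letter.x ^ m i * FreeMonoid.of (Letter.z i.succ)).prod := by
    intro m
    rw [bword_eq_mul_prod_ofFn]
    refine congrArg₂ (· * ·) ?_ ?_
    · simp [letterWord]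
    · refine congrArg List.prod (congrArg List.ofFn (funext fun i => ?_))
      rw [letterWord, dif_pos (by omega)]
      rfl
  constructor
  · rintro ⟨m, rfl⟩
    refine ⟨fun i => if h : i < t then m ⟨i, h⟩ else 0, ?_⟩
    rw [key]
    simp
  · rintro ⟨m, rfl⟩
    exact ⟨fun i => m i, key m⟩

theorem injOn_boundedLang_iff {t : ℕ} (μ : FreeMonoid (Letter t) →* UpperTri) :
    Set.InjOn (fun w => μ w) (boundedLang t) ↔
      ¬ ∃ m n, TripleCollision (μ (FreeMonoid.of Letter.x)).entries
        (fun i => (μ (letterWord t i)).entries) t m n := by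
  have hμ : ∀ m n : ℕ → ℕ,
      tword (μ (FreeMonoid.of Letter.x)).entries (fun i => (μ (letterWord t i)).entries) m t =
        tword (μ (FreeMonoid.of Letter.x)).entries (fun i => (μ (letterWord t i)).entries) n t ↔
      μ (bword (FreeMonoid.of Letter.x) (letterWord t) m t) =
        μ (bword (FreeMonoid.of Letter.x) (letterWord t) n t) := by
    intro m n
    rw [map_bword, map_bword, ← UpperTri.entries_injective.eq_iff, UpperTri.entries_bword,
      UpperTri.entries_bword]
  constructor
  · rintro hinj ⟨m, n, ⟨i, hi, hne⟩, h⟩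
    have := hinj (mem_boundedLang_iff.2 ⟨m, rfl⟩) (mem_boundedLang_iff.2 ⟨n, rfl⟩) ((hμ m n).1 h)
    refine hne (eq_of_bword_eq_bword (fun i hi => ?_) this i hi)
    exact ⟨Letter.z ⟨i, by omega⟩, by simp, by rw [letterWord, dif_pos (by omega)]⟩
  · intro hno w hw w' hw' hww'
    obtain ⟨m, rfl⟩ := mem_boundedLang_iff.1 hw
    obtain ⟨n, rfl⟩ := mem_boundedLang_iff.1 hw'
    by_contra hne
    refine hno ⟨m, n, ?_, (hμ m n).2 hww'⟩
    by_contra! hcon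
    exact hne (bword_congr _ _ _ _ _ fun i hi => by rw [hcon i hi])

theorem theorem1 (t : ℕ) (ht : 1 ≤ t) :
    ∃ decider : MatCode × List MatCode → Bool,
      Computable decider ∧
        ∀ μ : FreeMonoid (Letter t) →* UpperTri,
          (∀ i : Fin (t + 1),
            (μ (FreeMonoid.of (Letter.z i)) : Matrix (Fin 2) (Fin 2) ℚ).det ≠ 0) →
          (decider (morphismCode μ) = true ↔
            Set.InjOn (fun w => μ w) (boundedLang t)) := by
  obtain ⟨inst, hprim⟩ := (primrecPred_isNoninjectiveCode t).not
  refine ⟨_, hprim.to_comp, fun μ hμ => ?_⟩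
  rw [decide_eq_true_iff, injOn_boundedLang_iff, morphismCode]
  refine not_congr (isNoninjectiveCode_iff ht ?_ ?_)
  · intro i
    by_cases h : i < t + 1
    · rw [letterWord, dif_pos h]
      exact hμ _
    -- Beyond the alphabet the empty word maps to the identity matrix, which is also the default
    -- entry in `scaledEntry`.
    · rw [letterWord, dif_neg h, map_one]
      simp
  · intro i
    rw [scaledEntry, letterWord]
    by_cases h : i < t + 1
    · rw [dif_pos h, List.getD_eq_getElem _ _ (by simpa using h), List.getElem_ofFn]
    · rw [dif_neg h, List.getD_eq_default _ _ (by simpa using h), map_one]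
      simp [matCode, ratCode]
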